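/- For $\tau = x+iy$ in the upper half plane $\mathbb{H}$ and a formal variable $X$, let $\mathbb{C}[X]_m$ be the space of complex polynomials in $X$ of degree at most $m$. For $k\in\mathbb{Z}$, $m\in\mathbb{Z}_{\ge 0}$, $f:\mathbb{H}\to\mathbb{C}[X]_m$ and $\gamma=\begin{pmatrix}a&b\\c&d\end{pmatrix}\in\mathrm{SL}_2(\mathbb{Z})$ put $$\big(f|_{k,m}\gamma\big)(\tau)(X) = (cX+d)^m\,(c\tau+d)^{-k}\, f\Big(\frac{a\tau+b}{c\tau+d}\Big)\Big(\frac{aX+b}{cX+d}\Big).$$ Let $\Gamma_\infty=\big\{\pm\begin{pmatrix}1&n\\0&1\end{pmatrix} : n\in\mathbb{Z}\big\}$. For $k\equiv m \pmod 2$, $0\le j\le m$ and $s\in\mathbb{C}$ with $2\,\mathrm{Re}(s)+k>2+m$ define $$E_{k,m}(\tau,j,s)=\sum_{\gamma\in\Gamma_\infty\backslash\mathrm{SL}_2(\mathbb{Z})}\big((X-\tau)^j\,y^s\big)\big|_{k,m}\gamma .$$ Further set $$E^{\mathrm{hol}}_2(\tau)=1-24\sum_{n=1}^\infty\sigma_1(n)\,e^{2\pi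 i n\tau},\qquad E_2^{\mathrm{vec}}(\tau)=(X-\tau)\,E_2^{\mathrm{hol}}(\tau)-\frac{6}{\pi i}\in\mathbb{C}[X]_1 .$$ **Proposition.** Let $\tau\in\mathbb{H}$. For $j\in\{0,1\}$ the series $E_{1,1}(\tau,j,s)$ converges absolutely for $\mathrm{Re}(s)>1$ and has a meromorphic continuation to all $s\in\mathbb{C}$. The continuation of $E_{1,1}(\tau,1,s)$ is holomorphic at $s=0$, that of $E_{1,1}(\tau,0,s)$ has at most a simple pole at $s=1$, and $$E_2^{\mathrm{vec}}(\tau)=E_{1,1}(\tau,1,0)+2i\,\mathrm{Res}_{s=1}E_{1,1}(\tau,0,s).$$ Here convergence, meromorphy and residues of $\mathbb{C}[X]_1$-valued functions are understood coefficient by coefficient. -/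

import Mathlib

open UpperHalfPlane Polynomial Filter Topology
open scoped MatrixGroups

namespace VectorEisenstein

/-- The subgroup `Γ_∞ = {± T ^ n : n ∈ ℤ}` of `SL(2, ℤ)`. -/
def GammaInf : Subgroup SL(2, ℤ) where
  carrier := {γ | ∃ n : ℤ, γ = ModularGroup.T ^ n ∨ γ = -ModularGroup.T ^ n}
  one_mem' := ⟨0, Or.inl (by simp)⟩
  mul_mem' := by
    rintro _ _ ⟨n, rfl | rfl⟩ ⟨k, rfl | rfl⟩
    · exact ⟨n + k, Or.inl (zpow_add _ _ _).symm⟩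
    · exact ⟨n + k, Or.inr (by rw [zpow_add, mul_neg])⟩
    · exact ⟨n + k, Or.inr (by rw [zpow_add, neg_mul])⟩
    · exact ⟨n + k, Or.inl (by rw [zpow_add, neg_mul_neg])⟩
  inv_mem' := by
    rintro _ ⟨n, rfl | rfl⟩
    · exact ⟨-n, Or.inl (zpow_neg _ _).symm⟩
    · exact ⟨-n, Or.inr (by rw [zpow_neg]; exact inv_neg)⟩

/-- The set `Γ_∞ \ SL(2, ℤ)` of right cosets `Γ_∞ γ`. -/
abbrev Cosets : Type := Quotient (QuotientGroup.rightRel GammaInf)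

/-- The polynomial `(c X + d) ^ m * p ((a X + b) / (c X + d))`, for a polynomial `p` of degree at
most `m`, where `a, b, c, d` are the entries of `γ`. -/
noncomputable def polySlash (m : ℕ) (p : ℂ[X]) (γ : SL(2, ℤ)) : ℂ[X] :=
  ∑ i ∈ Finset.range (m + 1),
    C (p.coeff i) * (C (γ 0 0 : ℂ) * X + C (γ 0 1 : ℂ)) ^ i *
      (C (γ 1 0 : ℂ) * X + C (γ 1 1 : ℂ)) ^ (m - i)

/-- The slash action `(f |_{k, m} γ)(τ)(X) = (c X + d) ^ m (c τ + d) ^ (-k) f(γ τ)(γ X)` on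
functions `f` from the upper half plane to polynomials of degree at most `m`. -/
noncomputable def slash (k : ℤ) (m : ℕ) (f : ℍ → ℂ[X]) (γ : SL(2, ℤ)) (τ : ℍ) : ℂ[X] :=
  C (((γ 1 0 : ℂ) * (τ : ℂ) + (γ 1 1 : ℂ)) ^ (-k)) * polySlash m (f (γ • τ)) γ

/-- The function `τ ↦ (X - τ) ^ j * y ^ s`, where `y = Im τ`. -/
noncomputable def seed (j : ℕ) (s : ℂ) (τ : ℍ) : ℂ[X] :=
  (X - C (τ : ℂ)) ^ j * C ((τ.im : ℂ) ^ s)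

theorem polySlash_seed {m j : ℕ} (hj : j ≤ m) (s : ℂ) (τ : ℍ) (γ : SL(2, ℤ)) :
    polySlash m (seed j s τ) γ =
      C ((τ.im : ℂ) ^ s) *
        ((C (γ 0 0 : ℂ) * X + C (γ 0 1 : ℂ)) -
          C (τ : ℂ) * (C (γ 1 0 : ℂ) * X + C (γ 1 1 : ℂ))) ^ j *
        (C (γ 1 0 : ℂ) * X + C (γ 1 1 : ℂ)) ^ (m - j) := by
  unfold polySlash seed
  generalize (C (γ 0 0 : ℂ) * X + C (γ 0 1 : ℂ)) = A
  generalize (C (γ 1 0 : ℂ) * X + C (γ 1 1 : ℂ)) = B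
  have h : Finset.range (j + 1) ⊆ Finset.range (m + 1) :=
    Finset.range_subset_range.2 (by omega)
  rw [← Finset.sum_subset h, sub_eq_add_neg A, add_pow, Finset.mul_sum, Finset.sum_mul]
  · refine Finset.sum_congr rfl fun i hi => ?_
    have hi' : i ≤ j := by simpa [Nat.lt_succ_iff] using hi
    have hB : B ^ (m - i) = B ^ (j - i) * B ^ (m - j) := by
      rw [← pow_add]; congr 1; omega
    rw [coeff_mul_C, sub_eq_add_neg X, ← C_neg, coeff_X_add_C_pow, hB, ← neg_mul, mul_pow, ← C_neg]
    simp only [map_mul, map_pow, map_natCast]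
    ring
  · intro i _ hi
    have hi' : j < i := by simpa [Nat.lt_succ_iff] using hi
    rw [coeff_mul_C, sub_eq_add_neg X, ← C_neg, coeff_X_add_C_pow, Nat.choose_eq_zero_of_lt hi']
    simp

theorem slash_seed_T_zpow_mul {k : ℤ} {m j : ℕ} (hj : j ≤ m) (s : ℂ) (n : ℤ) (γ : SL(2, ℤ))
    (τ : ℍ) :
    slash k m (seed j s) (ModularGroup.T ^ n * γ) τ = slash k m (seed j s) γ τ := by
  have h00 : (ModularGroup.T ^ n * γ) 0 0 = γ 0 0 + n * γ 1 0 := by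
    simp [Matrix.SpecialLinearGroup.coe_mul, ModularGroup.coe_T_zpow, Matrix.mul_apply]
  have h01 : (ModularGroup.T ^ n * γ) 0 1 = γ 0 1 + n * γ 1 1 := by
    simp [Matrix.SpecialLinearGroup.coe_mul, ModularGroup.coe_T_zpow, Matrix.mul_apply]
  have h10 : (ModularGroup.T ^ n * γ) 1 0 = γ 1 0 := by
    simp
  have h11 : (ModularGroup.T ^ n * γ) 1 1 = γ 1 1 := by
    simp
  unfold slash
  rw [polySlash_seed hj, polySlash_seed hj, h00, h01, h10, h11, mul_smul,
    ModularGroup.coe_T_zpow_smul_eq, ModularGroup.im_T_zpow_smul]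
  push_cast
  simp only [map_add, map_mul]
  ring

theorem slash_seed_neg {k : ℤ} {m j : ℕ} (hj : j ≤ m) (hkm : Even (k - m)) (s : ℂ)
    (γ : SL(2, ℤ)) (τ : ℍ) :
    slash k m (seed j s) (-γ) τ = slash k m (seed j s) γ τ := by
  have hn : ∀ a b : Fin 2, (-γ) a b = -γ a b := fun a b => rfl
  unfold slash
  rw [polySlash_seed hj, polySlash_seed hj, ModularGroup.SL_neg_smul]
  simp only [hn]
  generalize C (γ • τ : ℍ).1 = t
  generalize C (((γ • τ : ℍ).im : ℂ) ^ s) = t'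
  push_cast
  simp only [map_neg]
  have e1 : -C (γ 0 0 : ℂ) * X + -C (γ 0 1 : ℂ) = -(C (γ 0 0 : ℂ) * X + C (γ 0 1 : ℂ)) := by ring
  have e2 : -C (γ 1 0 : ℂ) * X + -C (γ 1 1 : ℂ) = -(C (γ 1 0 : ℂ) * X + C (γ 1 1 : ℂ)) := by ring
  have e3 : -(γ 1 0 : ℂ) * τ + -(γ 1 1 : ℂ) = (-1) * ((γ 1 0 : ℂ) * τ + (γ 1 1 : ℂ)) := by ring
  rw [e1, e2, e3, mul_zpow]
  generalize (C (γ 0 0 : ℂ) * X + C (γ 0 1 : ℂ)) = A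
  generalize (C (γ 1 0 : ℂ) * X + C (γ 1 1 : ℂ)) = B
  have e4 : -A - t * -B = -(A - t * B) := by ring
  have e5 : C ((-1 : ℂ) ^ (-k)) * ((-1) ^ j * (-1) ^ (m - j)) = (1 : ℂ[X]) := by
    have h2 : (-1 : ℂ) ^ (-k) = (-1) ^ m := by
      rw [← zpow_natCast, show -k = m + -(k + m) by ring, zpow_add₀ (by norm_num)]
      have : Even (-(k + m)) := by
        have := hkm.add (even_two_mul (m : ℤ))
        rw [even_neg, show k + (m : ℤ) = k - m + 2 * m by ring]
        exact this
      rw [this.neg_one_zpow, mul_one]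
    rw [h2, ← pow_add, Nat.add_sub_cancel' hj, map_pow, map_neg, map_one, ← mul_pow]
    norm_num
  rw [e4, neg_pow (A - t * B), neg_pow B, map_mul]
  linear_combination (C (((γ 1 0 : ℂ) * τ + (γ 1 1 : ℂ)) ^ (-k)) * t' * (A - t * B) ^ j *
    B ^ (m - j)) * e5

/-- For `k ≡ m` modulo `2`, the summand of the Eisenstein series depends only on the coset
`Γ_∞ γ`. -/
theorem slash_seed_eq_of_rightRel {k : ℤ} {m j : ℕ} (hj : j ≤ m) (hkm : Even (k - m)) (s : ℂ)
    (τ : ℍ) (γ δ : SL(2, ℤ)) (h : QuotientGroup.rightRel GammaInf γ δ) :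
    slash k m (seed j s) γ τ = slash k m (seed j s) δ τ := by
  rw [QuotientGroup.rightRel_apply] at h
  obtain ⟨n, hn | hn⟩ := h
  · rw [mul_inv_eq_iff_eq_mul.1 hn, slash_seed_T_zpow_mul hj]
  · rw [mul_inv_eq_iff_eq_mul.1 hn, neg_mul, slash_seed_neg hj hkm, slash_seed_T_zpow_mul hj]

/-- The summand of the Eisenstein series at a coset in `Γ_∞ \ SL(2, ℤ)`. -/
noncomputable def summand (k : ℤ) (m j : ℕ) (hj : j ≤ m) (hkm : Even (k - m)) (τ : ℍ) (s : ℂ) :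
    Cosets → ℂ[X] :=
  Quotient.lift (fun γ => slash k m (seed j s) γ τ) (slash_seed_eq_of_rightRel hj hkm s τ)

/-- The vector-valued real-analytic Eisenstein series
`E_{k, m}(τ, j, s) = ∑_{γ ∈ Γ_∞ \ SL(2, ℤ)} ((X - τ) ^ j y ^ s) |_{k, m} γ`
for `2 Re s + k > 2 + m`. The sum is taken coefficient by coefficient. -/
noncomputable def eisensteinSeries (k : ℤ) (m j : ℕ) (hj : j ≤ m) (hkm : Even (k - m)) (τ : ℍ)
    (s : ℂ) : ℂ[X] :=
  ∑ i ∈ Finset.range (m + 1), monomial i (∑' q : Cosets, (summand k m j hj hkm τ s q).coeff i)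

/-- `F` is the meromorphic continuation to all `s ∈ ℂ` of `s ↦ E_{k, m}(τ, j, s)`, as a function
with values in the polynomials of degree at most `m`. Meromorphy is meant coefficient by
coefficient, and the normal form says that `F` takes the correct value at each point where it has
no pole, that is, removable singularities are removed. -/
structure IsContinuation (k : ℤ) (m j : ℕ) (hj : j ≤ m) (hkm : Even (k - m)) (τ : ℍ)
    (F : ℂ → ℂ[X]) : Prop where
  mem_degreeLE : ∀ s, F s ∈ degreeLE ℂ m
  meromorphic : ∀ i, MeromorphicNFOn (fun s => (F s).coeff i) Set.univ
  eq_series : ∀ s : ℂ, 2 + (m : ℝ) < 2 * s.re + k → F s = eisensteinSeries k m j hj hkm τ s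

/-- The residue at `z` of a function that is meromorphic at `z`: the value of
`(2 π i)⁻¹ ∮ f(w) dw` over all sufficiently small circles around `z`. -/
noncomputable def residue (f : ℂ → ℂ) (z : ℂ) : ℂ :=
  limUnder (𝓝[>] (0 : ℝ)) fun r : ℝ => (2 * Real.pi * Complex.I)⁻¹ * ∮ w in C(z, r), f w

/-- The residue of a function with values in the polynomials of degree at most `m`. -/
noncomputable def polyResidue (m : ℕ) (F : ℂ → ℂ[X]) (z : ℂ) : ℂ[X] :=
  ∑ i ∈ Finset.range (m + 1), monomial i (residue (fun s => (F s).coeff i) z)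

/-- The quasi-modular Eisenstein series `1 - 24 ∑_{n ≥ 1} σ₁(n) exp(2 π i n τ)`. -/
noncomputable def E2hol (τ : ℍ) : ℂ :=
  1 - 24 * ∑' n : ℕ+, (ArithmeticFunction.sigma 1 (n : ℕ) : ℂ) *
    Complex.exp (2 * Real.pi * Complex.I * (n : ℂ) * (τ : ℂ))

/-- The vector-valued analogue `(X - τ) E₂^hol(τ) - 6 / (π i)` of the weight `2` Eisenstein
series. -/
noncomputable def E2vec (τ : ℍ) : ℂ[X] :=
  (X - C (τ : ℂ)) * C (E2hol τ) - C (6 / (Real.pi * Complex.I))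

end VectorEisenstein

/-! Put v = cτ + d and y = Im τ, so Im γτ = y/|v|². Since det γ = 1, aX + b − γτ(cX + d) = (X −
τ)/v, and E_{1,1}(τ,1,s) = (X − τ) W₂(s) with W₂(s) = ∑ v⁻² Im(γτ)^s (`weightTwo`). For j = 0 the
summand is (cX + d)/v · Im(γτ)^s. From cX + d = v + c(X − τ) and c = (v − v̄)/(2iy) one gets
E_{1,1}(τ,0,s) = W₀(s) + (X − τ)(W₀(s) − y W₂(s − 1))/(2iy) with W₀(s) = ∑ Im(γτ)^s (`weightZero`).

It remains to continue W₀ and W₂, and to show that W₀ has a simple pole at 1 with residue 3/π, while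
W₂ is holomorphic at 0 with W₂(0) = E₂^hol − 3/(πy). Then 2i times the residue of E_{1,1}(τ,0,s) is
6i/π + 3(X − τ)/(πy): the second term cancels the nonholomorphic part of W₂(0), and the first equals
−6/(πi).

Continuation: up to the factor 2ζ coming from common divisors and signs (`latticeEquiv`,
`tsum_epsteinTerm_eq`), W₀ and W₂ are Epstein zeta functions ∑ v̄^j |v|^(−2s) over the whole
lattice, j = 0, 2. These are Mellin transforms of ∑ v̄^j exp(−πt|v|²/y), whose functional equations
`theta_zero_one_div` and `theta_two_one_div` come from Poisson summation in one variable.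

Value at 0: this is Hecke's trick. The weight two series does not converge absolutely at s = 0.
Adding s/(s + 1) · |v|^(−2(s+1)) and a telescoping difference makes it O(|v|⁻³) uniformly in s
(`norm_conjPow_sub_le`). Letting s → 0 gives G₂, and the added Epstein zeta function contributes π/y
through its pole, so the limit is G₂ − π/y. -/

namespace VectorEisenstein

/-! ### Lattice points and convergence of lattice sums. -/

/-- The point `m τ + n` of the lattice spanned by `τ` and `1`. -/
noncomputable def latticePoint (τ : ℍ) (p : ℤ × ℤ) : ℂ := p.1 * τ + p.2

@[simp] theorem latticePoint_zero (τ : ℍ) : latticePoint τ 0 = 0 := by simp [latticePoint]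

theorem latticePoint_re (τ : ℍ) (p : ℤ × ℤ) : (latticePoint τ p).re = p.1 * τ.re + p.2 := by
  simp [latticePoint]

theorem latticePoint_im (τ : ℍ) (p : ℤ × ℤ) : (latticePoint τ p).im = p.1 * τ.im := by
  simp [latticePoint]

theorem r_le_norm_latticePoint (τ : ℍ) {p : ℤ × ℤ} (hp : p ≠ 0) :
    EisensteinSeries.r τ ≤ ‖latticePoint τ p‖ := by
  have hx : ![p.1, p.2] ≠ 0 := by
    contrapose! hp
    exact Prod.ext (by simpa using congrFun hp 0) (by simpa using congrFun hp 1)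
  have h1 : (1 : ℝ) ≤ ‖![p.1, p.2]‖ := by
    rw [EisensteinSeries.norm_eq_max_natAbs]
    have : p.1 ≠ 0 ∨ p.2 ≠ 0 := by
      by_contra! h
      exact hp (Prod.ext h.1 h.2)
    have h2 : 1 ≤ max (![p.1, p.2] 0).natAbs (![p.1, p.2] 1).natAbs := by
      simp only [Matrix.cons_val_zero, Matrix.cons_val_one]
      omega
    exact_mod_cast h2
  have := EisensteinSeries.r_mul_max_le τ hx
  simp only [Matrix.cons_val_zero, Matrix.cons_val_one] at this
  exact (le_mul_of_one_le_right (EisensteinSeries.r_pos τ).le h1).trans this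

theorem norm_latticePoint_pos (τ : ℍ) {p : ℤ × ℤ} (hp : p ≠ 0) : 0 < ‖latticePoint τ p‖ :=
  (EisensteinSeries.r_pos τ).trans_le (r_le_norm_latticePoint τ hp)

theorem latticePoint_ne_zero (τ : ℍ) {p : ℤ × ℤ} (hp : p ≠ 0) : latticePoint τ p ≠ 0 :=
  norm_pos_iff.1 (norm_latticePoint_pos τ hp)

theorem summable_norm_latticePoint_rpow (τ : ℍ) {k : ℝ} (hk : 2 < k) :
    Summable fun p => ‖latticePoint τ p‖ ^ (-k) := by
  have h := ((EisensteinSeries.summable_one_div_norm_rpow hk).mul_left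
    (EisensteinSeries.r τ ^ (-k))).of_nonneg_of_le (fun x => by positivity)
    (EisensteinSeries.summand_bound τ (k := k) (by linarith))
  rw [← (finTwoArrowEquiv _).symm.summable_iff] at h
  exact h.congr fun p => by simp [latticePoint]

/-- Comparison with ∑ |v|⁻³: the function x^(j+3) exp(−t x²) is bounded on x ≥ 0. -/
theorem summable_norm_latticePoint_pow_mul_exp (τ : ℍ) (j : ℕ) {t : ℝ} (ht : 0 < t) :
    Summable fun p => ‖latticePoint τ p‖ ^ j * Real.exp (-t * ‖latticePoint τ p‖ ^ 2) := by
  have hlim : Tendsto (fun x : ℝ => x ^ (j + 3) * Real.exp (-t * x ^ 2)) atTop (𝓝 0) := by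
    have h1 := (Real.tendsto_pow_mul_exp_neg_atTop_nhds_zero (j + 3)).comp
      (tendsto_id.const_mul_atTop ht)
    have h2 : Tendsto (fun x : ℝ => (t ^ (j + 3))⁻¹ * ((t * x) ^ (j + 3) * Real.exp (-(t * x))))
        atTop (𝓝 0) := by simpa using h1.const_mul (t ^ (j + 3))⁻¹
    refine squeeze_zero' ?_ ?_ h2
    · filter_upwards [eventually_ge_atTop 0] with x hx using by positivity
    · filter_upwards [eventually_ge_atTop 1] with x hx
      rw [mul_pow, mul_assoc, inv_mul_cancel_left₀ (by positivity)]
      gcongr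
      nlinarith [mul_nonneg ht.le (mul_nonneg (sub_nonneg.2 hx) (zero_le_one.trans hx))]
  have hcont : Continuous fun x : ℝ => x ^ (j + 3) * Real.exp (-t * x ^ 2) := by fun_prop
  obtain ⟨B, hB⟩ : ∃ B, ∀ x : ℝ, 0 ≤ x → x ^ (j + 3) * Real.exp (-t * x ^ 2) ≤ B := by
    obtain ⟨N, hN⟩ := (hlim.eventually (gt_mem_nhds one_pos)).exists_forall_of_atTop
    obtain ⟨M, hM⟩ := (isCompact_Icc (a := (0 : ℝ)) (b := N)).exists_bound_of_continuousOn
      hcont.continuousOn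
    refine ⟨max M 1, fun x hx => ?_⟩
    rcases le_total x N with h | h
    · exact (Real.le_norm_self _).trans ((hM x ⟨hx, h⟩).trans (le_max_left _ _))
    · exact (hN x h).le.trans (le_max_right _ _)
  have hs := (summable_norm_latticePoint_rpow τ (k := 3) (by norm_num)).mul_left B
  rw [← Finset.summable_compl_iff {(0 : ℤ × ℤ)}] at hs ⊢
  refine hs.of_nonneg_of_le (fun p => by positivity) fun ⟨p, hp⟩ => ?_
  have hp' : p ≠ 0 := by simpa using hp
  have hpos := norm_latticePoint_pos τ hp'
  rw [Real.rpow_neg hpos.le, ← div_eq_mul_inv, le_div_iff₀ (by positivity)]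
  refine le_trans (le_of_eq ?_) (hB _ hpos.le)
  norm_cast
  ring

/-! ### Continuity and decay of general exponential sums. -/

section Theta

variable {ι : Type*} {a : ι → ℂ} {q : ι → ℝ} {δ : ℝ}

theorem continuousOn_tsum_mul_exp (hq : ∀ i, a i = 0 ∨ 0 ≤ q i)
    (hs : ∀ t : ℝ, 0 < t → Summable fun i => ‖a i‖ * Real.exp (-q i * t)) :
    ContinuousOn (fun t : ℝ => ∑' i, a i * (Real.exp (-q i * t) : ℂ)) (Set.Ioi 0) := by
  intro t₀ (ht₀ : 0 < t₀)
  have h : ContinuousOn (fun t : ℝ => ∑' i, a i * (Real.exp (-q i * t) : ℂ))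
      (Set.Ici (t₀ / 2)) := by
    refine continuousOn_tsum (fun i => by fun_prop) (hs (t₀ / 2) (by positivity)) ?_
    intro i t (ht : t₀ / 2 ≤ t)
    rw [norm_mul, Complex.norm_real, Real.norm_eq_abs, Real.abs_exp]
    rcases hq i with h | h
    · simp [h]
    · gcongr ‖a i‖ * Real.exp ?_
      nlinarith
  exact (h.continuousAt (Ici_mem_nhds (by linarith))).continuousWithinAt

/-- For q ≥ δ and t ≥ 1 one has exp(−qt) ≤ exp(δ − δt) exp(−q), so the sum decays like exp(−δt),
faster than any power. -/
theorem isBigO_tsum_mul_exp (hδ : 0 < δ) (hq : ∀ i, a i = 0 ∨ δ ≤ q i)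
    (hs : ∀ t : ℝ, 0 < t → Summable fun i => ‖a i‖ * Real.exp (-q i * t)) (r : ℝ) :
    (fun t : ℝ => ∑' i, a i * (Real.exp (-q i * t) : ℂ)) =O[atTop] fun t => t ^ r := by
  have h1 : (fun t : ℝ => ∑' i, a i * (Real.exp (-q i * t) : ℂ)) =O[atTop]
      fun t : ℝ => Real.exp (-δ * t) := by
    refine Asymptotics.IsBigO.of_bound
      (Real.exp δ * ∑' i, ‖a i‖ * Real.exp (-q i * 1)) ?_
    filter_upwards [eventually_ge_atTop 1] with t ht
    have hb : ∀ i, ‖a i * (Real.exp (-q i * t) : ℂ)‖ ≤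
        Real.exp (δ - δ * t) * (‖a i‖ * Real.exp (-q i * 1)) := by
      intro i
      rw [norm_mul, Complex.norm_real, Real.norm_eq_abs, Real.abs_exp]
      rcases hq i with h | h
      · simp [h]
      · rw [mul_left_comm, ← Real.exp_add]
        gcongr ‖a i‖ * Real.exp ?_
        nlinarith [mul_nonneg (sub_nonneg.2 h) (sub_nonneg.2 ht)]
    have hs1 := (hs 1 one_pos).mul_left (Real.exp (δ - δ * t))
    refine (tsum_of_norm_bounded hs1.hasSum hb).trans (le_of_eq ?_)
    rw [tsum_mul_left, Real.norm_eq_abs, Real.abs_exp, sub_eq_add_neg, Real.exp_add, neg_mul]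
    ring
  exact h1.trans (isLittleO_exp_neg_mul_rpow_atTop hδ r).isBigO

end Theta

/-! ### Second derivative of the Jacobi theta function. -/

open Complex in
theorem summable_sq_mul_jacobiTheta₂_term (z : ℂ) {T : ℂ} (hT : 0 < T.im) :
    Summable fun n : ℤ => (2 * Real.pi * Complex.I * n) ^ 2 * jacobiTheta₂_term n z T := by
  refine ((summable_pow_mul_jacobiTheta₂_term_bound |z.im| hT 2).mul_left
    ((2 * Real.pi) ^ 2)).of_norm_bounded fun n => ?_
  have h := norm_jacobiTheta₂_term_le hT (le_refl |z.im|) le_rfl n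
  calc ‖(2 * Real.pi * Complex.I * n) ^ 2 * jacobiTheta₂_term n z T‖
      = (2 * Real.pi) ^ 2 * (|(n : ℝ)| ^ 2 * ‖jacobiTheta₂_term n z T‖) := by
        simp [abs_of_pos Real.pi_pos, -sq_abs]; ring
    _ ≤ _ := by push_cast at h ⊢; gcongr

-- Termwise differentiation, with a summable bound uniform on the strip |Im u| < |Im z| + 1.
open Complex in
theorem hasDerivAt_jacobiTheta₂' (z : ℂ) {T : ℂ} (hT : 0 < T.im) :
    HasDerivAt (jacobiTheta₂' · T)
      (∑' n : ℤ, (2 * Real.pi * Complex.I * n) ^ 2 * jacobiTheta₂_term n z T) z := by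
  have hU : IsOpen {u : ℂ | |u.im| < |z.im| + 1} :=
    isOpen_lt (continuous_abs.comp continuous_im) continuous_const
  have hz : z ∈ {u : ℂ | |u.im| < |z.im| + 1} := by simp
  have hd : ∀ (n : ℤ) (u : ℂ), HasDerivAt (jacobiTheta₂'_term n · T)
      ((2 * Real.pi * Complex.I * n) ^ 2 * jacobiTheta₂_term n u T) u := by
    intro n u
    have h1 : HasDerivAt
        (fun u : ℂ => 2 * Real.pi * Complex.I * n * u + Real.pi * Complex.I * n ^ 2 * T)
        (2 * Real.pi * Complex.I * n) u := by
      simpa using ((hasDerivAt_id u).const_mul (2 * Real.pi * Complex.I * n)).add_const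
        (Real.pi * Complex.I * n ^ 2 * T)
    have h2 := h1.cexp.const_mul (2 * Real.pi * Complex.I * n)
    refine h2.congr_deriv ?_
    simp only [jacobiTheta₂_term]; ring
  have hb : ∀ (n : ℤ) (u : ℂ), u ∈ {u : ℂ | |u.im| < |z.im| + 1} → ‖jacobiTheta₂'_term n u T‖ ≤
      2 * Real.pi * (|(n : ℝ)| ^ 1 *
        Real.exp (-Real.pi * (T.im * n ^ 2 - 2 * (|z.im| + 1) * |n|))) := by
    intro n u hu
    refine (norm_jacobiTheta₂'_term_le hT (le_of_lt hu) le_rfl n).trans (le_of_eq ?_)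
    push_cast; ring
  have hs : Summable fun n : ℤ => 2 * Real.pi * (|(n : ℝ)| ^ 1 *
        Real.exp (-Real.pi * (T.im * n ^ 2 - 2 * (|z.im| + 1) * |n|))) := by
    simpa using (summable_pow_mul_jacobiTheta₂_term_bound (|z.im| + 1) hT 1).mul_left (2 * Real.pi)
  have hdiff : ∀ n : ℤ, DifferentiableOn ℂ (jacobiTheta₂'_term n · T)
      {u : ℂ | |u.im| < |z.im| + 1} := fun n u _ =>
    (hd n u).differentiableAt.differentiableWithinAt
  have h1 := hasSum_deriv_of_summable_norm hs hdiff hU hb hz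
  have h2 := (differentiableOn_tsum_of_summable_norm hs hdiff hU hb).differentiableAt
    (hU.mem_nhds hz)
  have h3 := h2.hasDerivAt
  rw [← h1.tsum_eq] at h3
  simp only [(hd _ z).deriv] at h3
  exact h3

open Complex in
/-- The second derivative of the functional equation of `jacobiTheta₂` in the first variable. -/
theorem tsum_sq_mul_jacobiTheta₂_term (z : ℂ) {T : ℂ} (hT : 0 < T.im) :
    ∑' n : ℤ, (2 * Real.pi * Complex.I * n) ^ 2 * jacobiTheta₂_term n z T =
      1 / (-Complex.I * T) ^ (1 / 2 : ℂ) * cexp (-Real.pi * Complex.I * z ^ 2 / T) / T ^ 2 *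
        ((∑' n : ℤ, (2 * Real.pi * Complex.I * n) ^ 2 * jacobiTheta₂_term n (z / T) (-1 / T)) -
          4 * Real.pi * Complex.I * z * jacobiTheta₂' (z / T) (-1 / T) +
          ((2 * Real.pi * Complex.I * z) ^ 2 - 2 * Real.pi * Complex.I * T) *
            jacobiTheta₂ (z / T) (-1 / T)) := by
  have hT0 : T ≠ 0 := by rintro rfl; simp at hT
  have hT' : 0 < (-1 / T).im := by
    rw [neg_div, neg_im, one_div, inv_im, neg_div, neg_neg]
    exact div_pos hT (normSq_pos.2 hT0)
  have hlin : HasDerivAt (fun z : ℂ => z / T) (1 / T) z := (hasDerivAt_id z).div_const T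
  have hq : HasDerivAt (fun z : ℂ => -Real.pi * Complex.I * z ^ 2 / T)
      (-Real.pi * Complex.I * (2 * z) / T) z := by
    simpa using (((hasDerivAt_pow 2 z).const_mul (-Real.pi * Complex.I)).div_const T)
  have h0 : HasDerivAt (fun z => jacobiTheta₂ (z / T) (-1 / T))
      (jacobiTheta₂' (z / T) (-1 / T) * (1 / T)) z :=
    HasDerivAt.comp (h₂ := (jacobiTheta₂ · (-1 / T))) z
      (hasDerivAt_jacobiTheta₂_fst (z / T) hT') hlin
  have h1 : HasDerivAt (fun z => jacobiTheta₂' (z / T) (-1 / T)) _ z :=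
    HasDerivAt.comp (h₂ := (jacobiTheta₂' · (-1 / T))) z
      (hasDerivAt_jacobiTheta₂' (z / T) hT') hlin
  have hz : HasDerivAt (fun z : ℂ => 2 * Real.pi * Complex.I * z) (2 * Real.pi * Complex.I) z := by
    simpa using (hasDerivAt_id z).const_mul (2 * Real.pi * Complex.I)
  have hR := ((hq.cexp.const_mul (1 / (-Complex.I * T) ^ (1 / 2 : ℂ))).div_const T).mul
    (h1.sub (hz.mul h0))
  have hL := hasDerivAt_jacobiTheta₂' z hT
  -- The functional equation of `jacobiTheta₂'` is an identity of functions of z, so the derivatives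
  -- of both sides at z coincide.
  have heq : (jacobiTheta₂' · T) = _ := funext fun z => jacobiTheta₂'_functional_equation z T
  rw [heq] at hL
  rw [hL.unique hR, Pi.sub_apply, Pi.mul_apply]
  field_simp
  ring

/-! ### Gaussian lattice sums and Poisson summation in each row. -/

open ComplexConjugate

/-- The coefficient of the theta series with spherical polynomial `v ↦ conj v ^ j`, multiplied
by the Gaussian in `v`. -/
noncomputable def thetaTerm (j : ℕ) (τ : ℍ) (t : ℝ) (p : ℤ × ℤ) : ℂ :=
  conj (latticePoint τ p) ^ j *
    (Real.exp (-(Real.pi / τ.im * ‖latticePoint τ p‖ ^ 2) * t) : ℂ)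

theorem summable_thetaTerm (j : ℕ) (τ : ℍ) {t : ℝ} (ht : 0 < t) : Summable (thetaTerm j τ t) := by
  refine Summable.of_norm ((summable_norm_latticePoint_pow_mul_exp τ j
    (t := Real.pi / τ.im * t) (by have := τ.im_pos; positivity)).congr fun p => ?_)
  rw [thetaTerm, norm_mul, norm_pow, RCLike.norm_conj, Complex.norm_real, Real.norm_eq_abs,
    Real.abs_exp]
  congr 2
  ring

/-- The summand obtained from `thetaTerm 0` by Poisson summation in the second variable. -/
noncomputable def dualTerm (τ : ℍ) (t : ℝ) (p : ℤ × ℤ) : ℂ :=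
  Complex.exp (-Real.pi * τ.im * (t * p.1 ^ 2 + p.2 ^ 2 / t) -
    2 * Real.pi * Complex.I * p.1 * p.2 * τ.re)

/-- The exponent is symmetric under exchanging the two indices together with t ↦ 1/t. This symmetry
is the source of the functional equation of the theta series. -/
theorem dualTerm_swap (τ : ℍ) (t : ℝ) (p : ℤ × ℤ) :
    dualTerm τ (1 / t) p.swap = dualTerm τ t p := by
  simp only [dualTerm, Prod.fst_swap, Prod.snd_swap]
  congr 1
  push_cast
  rw [div_div_eq_mul_div]
  ring

theorem norm_dualTerm (τ : ℍ) (t : ℝ) (p : ℤ × ℤ) :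
    ‖dualTerm τ t p‖ = Real.exp (-(Real.pi * τ.im * t) * p.1 ^ 2) *
      Real.exp (-(Real.pi * τ.im / t) * p.2 ^ 2) := by
  rw [dualTerm, Complex.norm_exp, ← Real.exp_add]
  congr 1
  have : (-Real.pi * τ.im * (t * p.1 ^ 2 + p.2 ^ 2 / t) -
    2 * Real.pi * Complex.I * p.1 * p.2 * τ.re : ℂ) =
    ((-Real.pi * τ.im * (t * p.1 ^ 2 + p.2 ^ 2 / t) : ℝ) : ℂ) +
    ((-2 * Real.pi * p.1 * p.2 * τ.re : ℝ) : ℂ) * Complex.I := by push_cast; ring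
  rw [this]
  simp only [Complex.add_re, Complex.ofReal_re, Complex.re_ofReal_mul, Complex.I_re]
  ring

/-- The summand obtained from `thetaTerm 2` by Poisson summation in the second variable. -/
noncomputable def dualTerm₂ (τ : ℍ) (t : ℝ) (p : ℤ × ℤ) : ℂ :=
  (τ.im / (2 * Real.pi * t) - τ.im ^ 2 * (p.2 / t - p.1) ^ 2) * dualTerm τ t p

/-- The polynomial factor is homogeneous under the same exchange; the resulting t² raises the weight
from 1 to 3. -/
theorem dualTerm₂_swap (τ : ℍ) {t : ℝ} (ht : 0 < t) (p : ℤ × ℤ) :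
    dualTerm₂ τ (1 / t) p.swap = t ^ 2 * dualTerm₂ τ t p := by
  have ht' : (t : ℂ) ≠ 0 := by exact_mod_cast ht.ne'
  rw [dualTerm₂, dualTerm_swap, dualTerm₂, ← mul_assoc]
  congr 1
  have := Complex.ofReal_ne_zero.2 Real.pi_ne_zero
  simp only [Prod.fst_swap, Prod.snd_swap]
  push_cast
  field_simp
  ring

theorem summable_abs_pow_mul_exp (j : ℕ) {c : ℝ} (hc : 0 < c) :
    Summable fun n : ℤ => |(n : ℝ)| ^ j * Real.exp (-c * n ^ 2) := by
  refine (summable_pow_mul_jacobiTheta₂_term_bound 0 (T := c / Real.pi)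
    (by positivity) j).congr fun n => ?_
  push_cast
  congr 2
  field_simp
  ring

theorem summable_abs_pow_mul_norm_dualTerm (τ : ℍ) {t : ℝ} (ht : 0 < t) (i j : ℕ) :
    Summable fun p : ℤ × ℤ => |(p.1 : ℝ)| ^ i * |(p.2 : ℝ)| ^ j * ‖dualTerm τ t p‖ := by
  have hy := τ.im_pos
  refine ((summable_abs_pow_mul_exp i (c := Real.pi * τ.im * t)
    (by positivity)).mul_of_nonneg (summable_abs_pow_mul_exp j (c := Real.pi * τ.im / t)
    (by positivity)) (fun _ => by positivity) (fun _ => by positivity)).congr fun p => ?_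
  rw [norm_dualTerm]
  ring

theorem summable_dualTerm (τ : ℍ) {t : ℝ} (ht : 0 < t) : Summable (dualTerm τ t) :=
  Summable.of_norm (by simpa using summable_abs_pow_mul_norm_dualTerm τ ht 0 0)

theorem summable_dualTerm₂ (τ : ℍ) {t : ℝ} (ht : 0 < t) : Summable (dualTerm₂ τ t) := by
  have h0 := (summable_abs_pow_mul_norm_dualTerm τ ht 0 0).mul_left (τ.im / (2 * Real.pi * t))
  have h1 := (summable_abs_pow_mul_norm_dualTerm τ ht 0 2).mul_left (2 * τ.im ^ 2 / t ^ 2)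
  have h2 := (summable_abs_pow_mul_norm_dualTerm τ ht 2 0).mul_left (2 * τ.im ^ 2)
  refine ((h0.add h1).add h2).of_norm_bounded fun p => ?_
  have hy := τ.im_pos
  rw [dualTerm₂, norm_mul, ← mul_assoc, ← mul_assoc _ _ ‖_‖, ← mul_assoc _ _ ‖_‖, ← add_mul,
    ← add_mul]
  gcongr
  have : (τ.im / (2 * Real.pi * t) - τ.im ^ 2 * (p.2 / t - p.1) ^ 2 : ℂ) =
      ((τ.im / (2 * Real.pi * t) - τ.im ^ 2 * (p.2 / t - p.1) ^ 2 : ℝ) : ℂ) := by push_cast; ring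
  rw [this, Complex.norm_real]
  refine (norm_sub_le _ _).trans ?_
  rw [Real.norm_of_nonneg (by positivity), Real.norm_of_nonneg (by positivity)]
  have h3 : ((p.2 : ℝ) / t - p.1) ^ 2 ≤ 2 * ((p.2 : ℝ) / t) ^ 2 + 2 * (p.1 : ℝ) ^ 2 := by
    nlinarith [sq_nonneg ((p.2 : ℝ) / t + p.1)]
  have h4 := mul_le_mul_of_nonneg_left h3 (sq_nonneg τ.im)
  have e : 2 * τ.im ^ 2 / t ^ 2 * ((p.2 : ℝ)) ^ 2 = τ.im ^ 2 * (2 * ((p.2 : ℝ) / t) ^ 2) := by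
    field_simp
  simp only [sq_abs, pow_zero, mul_one, one_mul, e]
  linarith

section Rows

variable (τ : ℍ) {t : ℝ} (m : ℤ)

theorem im_I_mul_pos (ht : 0 < t) : 0 < (Complex.I * (τ.im / t : ℂ)).im := by
  have : (Complex.I * (τ.im / t : ℂ)) = ((τ.im / t : ℝ) : ℂ) * Complex.I := by push_cast; ring
  rw [this, Complex.im_ofReal_mul, Complex.I_im, mul_one]
  exact div_pos τ.im_pos ht

theorem dualTerm_eq (k : ℤ) : dualTerm τ t (m, k) =
    Complex.exp (-Real.pi * τ.im * t * m ^ 2) *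
      jacobiTheta₂_term k (-(m * τ.re)) (Complex.I * (τ.im / t)) := by
  rw [dualTerm, jacobiTheta₂_term, ← Complex.exp_add]
  congr 1
  linear_combination (-(Real.pi * k ^ 2 * τ.im / t) : ℂ) * Complex.I_sq

/-- With x = Re τ, |mτ + n|² = (n + mx)² + m²y² makes a row a Jacobi theta series with modulus −1/T,
T = iy/t. Jacobi's functional equation is thus Poisson summation in n. -/
theorem exp_normSq_latticePoint_eq (ht : 0 < t) (n : ℤ) :
    (Real.exp (-(Real.pi / τ.im * ‖latticePoint τ (m, n)‖ ^ 2) * t) : ℂ) =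
      Complex.exp (-Real.pi * τ.im * t * m ^ 2) *
      (Complex.exp (-Real.pi * Complex.I * (-(m * τ.re)) ^ 2 / (Complex.I * (τ.im / t))) *
        jacobiTheta₂_term n (-(m * τ.re) / (Complex.I * (τ.im / t)))
          (-1 / (Complex.I * (τ.im / t)))) := by
  have ht' : (t : ℂ) ≠ 0 := by exact_mod_cast ht.ne'
  have hy : (τ.im : ℂ) ≠ 0 := by exact_mod_cast τ.im_pos.ne'
  rw [jacobiTheta₂_term, ← Complex.exp_add, ← Complex.exp_add, Complex.ofReal_exp, Complex.sq_norm,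
    Complex.normSq_apply, latticePoint_re, latticePoint_im]
  congr 1
  push_cast
  field_simp
  ring

theorem tsum_row_thetaTerm_zero (ht : 0 < t) : ∑' n : ℤ, thetaTerm 0 τ t (m, n) =
    (-Complex.I * (Complex.I * (τ.im / t))) ^ (1 / 2 : ℂ) * ∑' k : ℤ, dualTerm τ t (m, k) := by
  have hT := im_I_mul_pos τ ht
  have hC : (-Complex.I * (Complex.I * (τ.im / t))) ^ (1 / 2 : ℂ) ≠ 0 := by
    refine (Complex.cpow_ne_zero_iff_of_exponent_ne_zero (by norm_num)).2 ?_
    refine mul_ne_zero (by simp) fun h => ?_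
    simp [h] at hT
  have h1 := jacobiTheta₂_functional_equation (-(m * τ.re)) (Complex.I * (τ.im / t))
  simp only [thetaTerm, pow_zero, one_mul, dualTerm_eq, exp_normSq_latticePoint_eq τ m ht,
    tsum_mul_left]
  change _ * (_ * jacobiTheta₂ _ _) = _ * (_ * jacobiTheta₂ _ _)
  rw [h1]
  generalize (-Complex.I * (Complex.I * (τ.im / t))) ^ (1 / 2 : ℂ) = C at hC
  field_simp

/-- With z = −m Re τ one has v̄ = n − z − imy, so v̄² is a quadratic polynomial in n and the row is
a combination of the Jacobi theta function and its first two z-derivatives, each with a known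
transformation. -/
theorem tsum_row_thetaTerm_two (ht : 0 < t) : ∑' n : ℤ, thetaTerm 2 τ t (m, n) =
    (-Complex.I * (Complex.I * (τ.im / t))) ^ (1 / 2 : ℂ) * ∑' k : ℤ, dualTerm₂ τ t (m, k) := by
  have hT := im_I_mul_pos τ ht
  have ht' : (t : ℂ) ≠ 0 := by exact_mod_cast ht.ne'
  have hy : (τ.im : ℂ) ≠ 0 := by exact_mod_cast τ.im_pos.ne'
  have hπ := Complex.ofReal_ne_zero.2 Real.pi_ne_zero
  have hI := Complex.I_ne_zero
  have h0 := jacobiTheta₂_functional_equation (-(m * τ.re)) (Complex.I * (τ.im / t))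
  have h1 := jacobiTheta₂'_functional_equation (-(m * τ.re)) (Complex.I * (τ.im / t))
  have h2 := tsum_sq_mul_jacobiTheta₂_term (-(m * τ.re)) hT
  have hT0 : Complex.I * (τ.im / t : ℂ) ≠ 0 := by
    intro h; simp [h] at hT
  have hT' : 0 < (-1 / (Complex.I * (τ.im / t : ℂ))).im := by
    rw [neg_div, Complex.neg_im, one_div, Complex.inv_im, neg_div, neg_neg]
    exact div_pos hT (Complex.normSq_pos.2 hT0)
  have hC : (-Complex.I * (Complex.I * (τ.im / t))) ^ (1 / 2 : ℂ) ≠ 0 :=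
    (Complex.cpow_ne_zero_iff_of_exponent_ne_zero (by norm_num)).2
      (mul_ne_zero (by simp) hT0)
  have s0 := fun (z : ℂ) {T : ℂ} (hT : 0 < T.im) => hasSum_jacobiTheta₂_term z hT
  have s1 := fun (z : ℂ) {T : ℂ} (hT : 0 < T.im) => hasSum_jacobiTheta₂'_term z hT
  have s2 := fun (z : ℂ) {T : ℂ} (hT : 0 < T.im) => (summable_sq_mul_jacobiTheta₂_term z hT).hasSum
  simp only [jacobiTheta₂'_term] at s1
  set z : ℂ := -(m * τ.re) with hz
  set T : ℂ := Complex.I * (τ.im / t) with hTdef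
  -- Differentiating the n-th theta term in z multiplies it by D n, so powers of n become
  -- derivatives divided by powers of D.
  set D : ℂ := 2 * Real.pi * Complex.I with hD
  have hD0 : D ≠ 0 := by simp [hD, hπ]
  have hL : HasSum (fun n : ℤ => thetaTerm 2 τ t (m, n))
      (Complex.exp (-Real.pi * τ.im * t * m ^ 2) *
        Complex.exp (-Real.pi * Complex.I * z ^ 2 / T) *
        ((∑' n : ℤ, (D * n) ^ 2 * jacobiTheta₂_term n (z / T) (-1 / T)) / D ^ 2 -
          2 * (z + Complex.I * (m * τ.im)) / D * jacobiTheta₂' (z / T) (-1 / T) +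
          (z + Complex.I * (m * τ.im)) ^ 2 * jacobiTheta₂ (z / T) (-1 / T))) := by
    have := (((((s2 (z / T) hT').div_const (D ^ 2)).sub ((s1 (z / T) hT').mul_left
      (2 * (z + Complex.I * (m * τ.im)) / D))).add ((s0 (z / T) hT').mul_left
      ((z + Complex.I * (m * τ.im)) ^ 2))).mul_left
      (Complex.exp (-Real.pi * τ.im * t * m ^ 2) *
        Complex.exp (-Real.pi * Complex.I * z ^ 2 / T)))
    refine this.congr_fun fun n => ?_
    have e : conj (latticePoint τ (m, n)) = n - z - Complex.I * (m * τ.im) := by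
      apply Complex.ext
      · simp [latticePoint_re, hz]; ring
      · simp [latticePoint_im, hz]
    rw [thetaTerm, exp_normSq_latticePoint_eq τ m ht, e, ← hz, ← hTdef]
    generalize jacobiTheta₂_term n (z / T) (-1 / T) = φ
    field_simp
    ring
  have hR : HasSum (fun k : ℤ => dualTerm₂ τ t (m, k))
      (Complex.exp (-Real.pi * τ.im * t * m ^ 2) *
        ((τ.im / (2 * Real.pi * t) - (m * τ.im) ^ 2) * jacobiTheta₂ z T +
          2 * τ.im ^ 2 * m / (t * D) * jacobiTheta₂' z T - (τ.im / t) ^ 2 / D ^ 2 *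
          ∑' n : ℤ, (D * n) ^ 2 * jacobiTheta₂_term n z T)) := by
    have := ((((s0 z hT).mul_left (τ.im / (2 * Real.pi * t) - (m * τ.im) ^ 2 : ℂ)).add
      ((s1 z hT).mul_left (2 * τ.im ^ 2 * m / (t * D)))).sub ((s2 z hT).mul_left
      ((τ.im / t) ^ 2 / D ^ 2 : ℂ))).mul_left (Complex.exp (-Real.pi * τ.im * t * m ^ 2))
    refine this.congr_fun fun k => ?_
    rw [dualTerm₂, dualTerm_eq, ← hz, ← hTdef]
    generalize jacobiTheta₂_term k z T = φ
    field_simp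
    ring
  rw [hL.tsum_eq, hR.tsum_eq, h0, h1, h2]
  generalize jacobiTheta₂ (z / T) (-1 / T) = φ
  generalize jacobiTheta₂' (z / T) (-1 / T) = φ'
  generalize (∑' n : ℤ, (D * n) ^ 2 * jacobiTheta₂_term n (z / T) (-1 / T)) = φ''
  generalize hCC : (-Complex.I * T) ^ (1 / 2 : ℂ) = C at hC ⊢
  generalize Complex.exp (-Real.pi * Complex.I * z ^ 2 / T) = E
  generalize Complex.exp (-Real.pi * τ.im * t * m ^ 2) = E'
  simp only [hTdef, hD]
  clear_value z
  field_simp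
  ring_nf
  have h3 : Complex.I ^ 3 = -Complex.I := Complex.I_pow_three
  have h5 : Complex.I ^ 5 = Complex.I := by rw [pow_succ, Complex.I_pow_four, one_mul]
  have h6 : Complex.I ^ 6 = -1 := by rw [pow_succ, h5, Complex.I_mul_I]
  simp only [Complex.I_sq, h3, Complex.I_pow_four, h5, h6]
  ring

end Rows

/-! ### Theta series and their functional equations. -/

/-- The theta series with spherical polynomial `v ↦ conj v ^ j`. -/
noncomputable def theta (j : ℕ) (τ : ℍ) (t : ℝ) : ℂ := ∑' p, thetaTerm j τ t p

theorem theta_zero_eq (τ : ℍ) {t : ℝ} (ht : 0 < t) : theta 0 τ t =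
    (-Complex.I * (Complex.I * (τ.im / t))) ^ (1 / 2 : ℂ) * ∑' p, dualTerm τ t p := by
  rw [theta, (summable_thetaTerm 0 τ ht).tsum_prod, (summable_dualTerm τ ht).tsum_prod,
    ← tsum_mul_left]
  exact tsum_congr fun m => tsum_row_thetaTerm_zero τ m ht

theorem theta_two_eq (τ : ℍ) {t : ℝ} (ht : 0 < t) : theta 2 τ t =
    (-Complex.I * (Complex.I * (τ.im / t))) ^ (1 / 2 : ℂ) * ∑' p, dualTerm₂ τ t p := by
  rw [theta, (summable_thetaTerm 2 τ ht).tsum_prod, (summable_dualTerm₂ τ ht).tsum_prod,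
    ← tsum_mul_left]
  exact tsum_congr fun m => tsum_row_thetaTerm_two τ m ht

/-- The prefactor is √(y/t), and √(yt) = t √(y/t). This is the remaining power of t in both
functional equations. -/
theorem sqrt_im_div_one_div (τ : ℍ) {t : ℝ} (ht : 0 < t) :
    (-Complex.I * (Complex.I * (τ.im / (1 / t : ℝ)))) ^ (1 / 2 : ℂ) =
      t * (-Complex.I * (Complex.I * (τ.im / t))) ^ (1 / 2 : ℂ) := by
  have hy := τ.im_pos
  have e : ∀ b : ℂ, -Complex.I * (Complex.I * b) = b := fun b => by
    rw [neg_mul, ← mul_assoc, Complex.I_mul_I]; ring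
  have e2 : (1 / 2 : ℂ) = ((1 / 2 : ℝ) : ℂ) := by push_cast; rfl
  rw [e, e, e2, ← Complex.ofReal_div, ← Complex.ofReal_div, ← Complex.ofReal_cpow (by positivity),
    ← Complex.ofReal_cpow (by positivity), ← Complex.ofReal_mul, ← Real.sqrt_eq_rpow,
    ← Real.sqrt_eq_rpow]
  congr 1
  rw [show τ.im / (1 / t) = t ^ 2 * (τ.im / t) by field_simp, Real.sqrt_mul (sq_nonneg t),
    Real.sqrt_sq ht.le]

theorem theta_zero_one_div (τ : ℍ) {t : ℝ} (ht : 0 < t) : theta 0 τ (1 / t) = t * theta 0 τ t := by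
  rw [theta_zero_eq τ ht, theta_zero_eq τ (one_div_pos.2 ht), sqrt_im_div_one_div τ ht,
    ← (Equiv.prodComm ℤ ℤ).tsum_eq]
  simp only [Equiv.prodComm_apply, dualTerm_swap, mul_assoc]

theorem theta_two_one_div (τ : ℍ) {t : ℝ} (ht : 0 < t) :
    theta 2 τ (1 / t) = t ^ 3 * theta 2 τ t := by
  rw [theta_two_eq τ ht, theta_two_eq τ (one_div_pos.2 ht), sqrt_im_div_one_div τ ht,
    ← (Equiv.prodComm ℤ ℤ).tsum_eq]
  simp only [Equiv.prodComm_apply, dualTerm₂_swap τ ht, tsum_mul_left]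
  ring

/-- The coefficient `conj v ^ j` at a nonzero lattice point `v`, and `0` at the origin. -/
noncomputable def latticeCoeff (j : ℕ) (τ : ℍ) (p : ℤ × ℤ) : ℂ :=
  if p = 0 then 0 else conj (latticePoint τ p) ^ j

theorem norm_latticeCoeff_le (j : ℕ) (τ : ℍ) (p : ℤ × ℤ) :
    ‖latticeCoeff j τ p‖ ≤ ‖latticePoint τ p‖ ^ j := by
  rw [latticeCoeff]
  split_ifs
  · simp only [norm_zero]; positivity
  · rw [norm_pow, RCLike.norm_conj]

theorem latticeCoeff_eq_zero_or (j : ℕ) (τ : ℍ) (p : ℤ × ℤ) : latticeCoeff j τ p = 0 ∨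
    Real.pi / τ.im * EisensteinSeries.r τ ^ 2 ≤ Real.pi / τ.im * ‖latticePoint τ p‖ ^ 2 := by
  by_cases hp : p = 0
  · simp [latticeCoeff, hp]
  · right
    have := τ.im_pos
    have := EisensteinSeries.r_pos τ
    gcongr
    exact r_le_norm_latticePoint τ hp

theorem summable_norm_latticeCoeff_mul_exp (j : ℕ) (τ : ℍ) (t : ℝ) (ht : 0 < t) :
    Summable fun p => ‖latticeCoeff j τ p‖ *
      Real.exp (-(Real.pi / τ.im * ‖latticePoint τ p‖ ^ 2) * t) := by
  refine (summable_thetaTerm j τ ht).norm.of_nonneg_of_le (fun p => by positivity) fun p => ?_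
  rw [thetaTerm, norm_mul, norm_pow, RCLike.norm_conj, Complex.norm_real, Real.norm_eq_abs,
    Real.abs_exp]
  gcongr
  exact norm_latticeCoeff_le j τ p

theorem summable_latticeCoeff_mul_exp (j : ℕ) (τ : ℍ) {t : ℝ} (ht : 0 < t) :
    Summable fun p => latticeCoeff j τ p *
      (Real.exp (-(Real.pi / τ.im * ‖latticePoint τ p‖ ^ 2) * t) : ℂ) := by
  refine Summable.of_norm ((summable_norm_latticeCoeff_mul_exp j τ t ht).congr fun p => ?_)
  rw [norm_mul, Complex.norm_real, Real.norm_eq_abs, Real.abs_exp]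

/-- The origin contributes `0 ^ j`, which is 1 for j = 0 and 0 for j = 2; it is the constant term to
be removed before taking Mellin transforms. -/
theorem theta_eq_add (j : ℕ) (τ : ℍ) {t : ℝ} (ht : 0 < t) :
    theta j τ t = (0 : ℂ) ^ j + ∑' p, latticeCoeff j τ p *
      (Real.exp (-(Real.pi / τ.im * ‖latticePoint τ p‖ ^ 2) * t) : ℂ) := by
  rw [theta, (summable_thetaTerm j τ ht).tsum_eq_add_tsum_ite 0]
  congr 1
  · simp [thetaTerm]
  · refine tsum_congr fun p => ?_
    rw [latticeCoeff, thetaTerm]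
    split_ifs <;> simp

theorem continuousOn_theta (j : ℕ) (τ : ℍ) : ContinuousOn (theta j τ) (Set.Ioi 0) := by
  refine (continuousOn_const.add (continuousOn_tsum_mul_exp (a := latticeCoeff j τ)
    (q := fun p => Real.pi / τ.im * ‖latticePoint τ p‖ ^ 2) (fun p => Or.inr ?_)
    (summable_norm_latticeCoeff_mul_exp j τ))).congr fun t ht => theta_eq_add j τ ht
  have := τ.im_pos
  positivity

theorem isBigO_theta_sub (j : ℕ) (τ : ℍ) (r : ℝ) :
    (fun t => theta j τ t - (0 : ℂ) ^ j) =O[atTop] fun t : ℝ => t ^ r := by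
  have h : 0 < Real.pi / τ.im * EisensteinSeries.r τ ^ 2 := by
    have := τ.im_pos
    have := EisensteinSeries.r_pos τ
    positivity
  refine (isBigO_tsum_mul_exp h (latticeCoeff_eq_zero_or j τ)
    (summable_norm_latticeCoeff_mul_exp j τ) r).congr' ?_ EventuallyEq.rfl
  filter_upwards [eventually_gt_atTop 0] with t ht
  rw [theta_eq_add j τ ht, add_sub_cancel_left]

/-- The theta series `∑ exp (-π t |v|² / y)` and its functional equation. -/
noncomputable def thetaPair (τ : ℍ) : WeakFEPair ℂ where
  f := theta 0 τ
  g := theta 0 τ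
  k := 1
  ε := 1
  f₀ := 1
  g₀ := 1
  hf_int := (continuousOn_theta 0 τ).locallyIntegrableOn measurableSet_Ioi
  hg_int := (continuousOn_theta 0 τ).locallyIntegrableOn measurableSet_Ioi
  hk := one_pos
  hε := one_ne_zero
  h_feq t ht := by simpa using theta_zero_one_div τ ht
  hf_top r := by simpa using isBigO_theta_sub 0 τ r
  hg_top r := by simpa using isBigO_theta_sub 0 τ r

/-- The theta series `∑ conj v ^ 2 exp (-π t |v|² / y)` and its functional equation. -/
noncomputable def thetaPair₂ (τ : ℍ) : WeakFEPair ℂ where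
  f := theta 2 τ
  g := theta 2 τ
  k := 3
  ε := 1
  f₀ := 0
  g₀ := 0
  hf_int := (continuousOn_theta 2 τ).locallyIntegrableOn measurableSet_Ioi
  hg_int := (continuousOn_theta 2 τ).locallyIntegrableOn measurableSet_Ioi
  hk := by norm_num
  hε := one_ne_zero
  h_feq t ht := by
    have h : (t : ℝ) ^ (3 : ℝ) = t ^ 3 := by norm_cast
    rw [h, theta_two_one_div τ ht]
    simp
  hf_top r := by simpa using isBigO_theta_sub 2 τ r
  hg_top r := by simpa using isBigO_theta_sub 2 τ r

/-- Without constant terms the Mellin transform has no poles, which makes the weight two Λ entire.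
-/
theorem isStrongFEPair_thetaPair₂ (τ : ℍ) : IsStrongFEPair (thetaPair₂ τ) := ⟨rfl, rfl⟩

/-! ### Epstein zeta functions as Mellin transforms. -/

/-- The summand of the Epstein zeta function `∑ conj v ^ j |v| ^ (-2 s)`. -/
noncomputable def epsteinTerm (j : ℕ) (τ : ℍ) (s : ℂ) (p : ℤ × ℤ) : ℂ :=
  latticeCoeff j τ p * (‖latticePoint τ p‖ : ℂ) ^ (-2 * s)

theorem norm_epsteinTerm_le (j : ℕ) (τ : ℍ) (s : ℂ) (p : ℤ × ℤ) :
    ‖epsteinTerm j τ s p‖ ≤ ‖latticePoint τ p‖ ^ (-(2 * s.re - j)) := by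
  by_cases hp : p = 0
  · simp only [epsteinTerm, latticeCoeff, hp, if_pos, zero_mul, norm_zero]
    positivity
  · have h := norm_latticePoint_pos τ hp
    have e : (-2 * s).re = -(2 * s.re) := by simp
    rw [epsteinTerm, norm_mul, Complex.norm_cpow_eq_rpow_re_of_pos h, neg_sub, sub_eq_add_neg,
      Real.rpow_add h, Real.rpow_natCast, e]
    gcongr
    exact norm_latticeCoeff_le j τ p

theorem summable_epsteinTerm {j : ℕ} (τ : ℍ) {s : ℂ} (hs : 2 + j < 2 * s.re) :
    Summable (epsteinTerm j τ s) :=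
  (summable_norm_latticePoint_rpow τ (k := 2 * s.re - j) (by linarith)).of_norm_bounded
    (norm_epsteinTerm_le j τ s)

/-- Termwise, ∫ exp(−qt) t^(s−1) dt = Γ(s) q^(−s) with q = π|v|²/y. -/
theorem hasSum_mellin_theta {j : ℕ} (τ : ℍ) {s : ℂ} (hs : 2 + j < 2 * s.re) {L : ℂ}
    (hL : HasMellin (fun t => theta j τ t - (0 : ℂ) ^ j) s L) :
    L = Complex.Gamma s * (τ.im / Real.pi) ^ s * ∑' p, epsteinTerm j τ s p := by
  have hy := τ.im_pos
  have hs0 : 0 < s.re := by have : (0 : ℝ) ≤ j := j.cast_nonneg; linarith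
  have key : ∀ p, latticeCoeff j τ p / ((Real.pi / τ.im * ‖latticePoint τ p‖ ^ 2 : ℝ) : ℂ) ^ s =
      (τ.im / Real.pi) ^ s * epsteinTerm j τ s p := by
    intro p
    by_cases hp : p = 0
    · simp [epsteinTerm, latticeCoeff, hp]
    have h := norm_latticePoint_pos τ hp
    have e1 : ((‖latticePoint τ p‖ ^ 2 : ℝ) : ℂ) ^ s = (‖latticePoint τ p‖ : ℂ) ^ (2 * s) := by
      rw [pow_two, Complex.ofReal_mul, Complex.mul_cpow_ofReal_nonneg h.le h.le,
        Complex.cpow_ofNat_mul, pow_two]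
    have e2 : ((Real.pi / τ.im : ℝ) : ℂ) ^ s = ((τ.im / Real.pi : ℂ) ^ s)⁻¹ := by
      rw [← inv_div, Complex.ofReal_inv, Complex.inv_cpow, Complex.ofReal_div]
      rw [Complex.arg_ofReal_of_nonneg (by positivity)]
      exact Real.pi_ne_zero.symm
    rw [Complex.ofReal_mul, Complex.mul_cpow_ofReal_nonneg (by positivity) (by positivity), e1, e2,
      epsteinTerm, neg_mul, Complex.cpow_neg]
    field_simp
  have h := hasSum_mellin (a := latticeCoeff j τ)
    (p := fun p => Real.pi / τ.im * ‖latticePoint τ p‖ ^ 2)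
    (F := fun t => theta j τ t - (0 : ℂ) ^ j) (s := s) (fun p => ?_) hs0 (fun t ht => ?_) ?_
  · rw [hL.2] at h
    rw [← h.tsum_eq, mul_assoc, ← tsum_mul_left, ← tsum_mul_left]
    refine tsum_congr fun p => ?_
    rw [mul_div_assoc, key]
  · refine (latticeCoeff_eq_zero_or j τ p).imp id fun h => lt_of_lt_of_le ?_ h
    have := EisensteinSeries.r_pos τ
    positivity
  · rw [theta_eq_add j τ ht, add_sub_cancel_left]
    exact (summable_latticeCoeff_mul_exp j τ ht).hasSum
  · refine ((summable_epsteinTerm τ hs).mul_left ((τ.im / Real.pi : ℂ) ^ s)).norm.congr fun p => ?_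
    rw [← key, norm_div]
    by_cases hp : p = 0
    · simp [latticeCoeff, hp]
    · have h := norm_latticePoint_pos τ hp
      rw [Complex.norm_cpow_eq_rpow_re_of_pos (by positivity)]

theorem Λ_thetaPair (τ : ℍ) {s : ℂ} (hs : 1 < s.re) : (thetaPair τ).Λ s =
    Complex.Gamma s * (τ.im / Real.pi) ^ s * ∑' p, epsteinTerm 0 τ s p :=
  hasSum_mellin_theta τ (by push_cast; linarith)
    (by simpa [thetaPair] using (thetaPair τ).hasMellin (s := s) (by simpa [thetaPair] using hs))

theorem Λ_thetaPair₂ (τ : ℍ) {s : ℂ} (hs : 2 < s.re) : (thetaPair₂ τ).Λ s =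
    Complex.Gamma s * (τ.im / Real.pi) ^ s * ∑' p, epsteinTerm 2 τ s p :=
  hasSum_mellin_theta τ (by push_cast; linarith)
    (by simpa [thetaPair₂] using (isStrongFEPair_thetaPair₂ τ).hasMellin s)

/-! ### Hecke's trick in weight two. -/

/-- The function `conj v ^ j |v| ^ (-2 σ)`. -/
noncomputable def conjPow (j : ℕ) (σ : ℝ) (v : ℂ) : ℂ :=
  conj v ^ j * ((Complex.normSq v ^ (-σ) : ℝ) : ℂ)

theorem norm_conjPow (j : ℕ) (σ : ℝ) {v : ℂ} (hv : v ≠ 0) :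
    ‖conjPow j σ v‖ = ‖v‖ ^ (j - 2 * σ) := by
  have h : 0 < ‖v‖ := norm_pos_iff.2 hv
  rw [conjPow, norm_mul, norm_pow, RCLike.norm_conj, Complex.norm_real, Complex.normSq_eq_norm_sq,
    Real.norm_of_nonneg (by positivity), ← Real.rpow_natCast_mul h.le, ← Real.rpow_natCast,
    ← Real.rpow_add h]
  congr 1
  push_cast
  ring

theorem conj_mul_conjPow (j : ℕ) (σ : ℝ) (v : ℂ) :
    conj v * conjPow j σ v = conjPow (j + 1) σ v := by
  rw [conjPow, conjPow]; ring

theorem mul_conjPow_succ (j : ℕ) (σ : ℝ) {v : ℂ} (hv : v ≠ 0) :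
    v * conjPow (j + 1) (σ + 1) v = conjPow j σ v := by
  have h : 0 < Complex.normSq v := Complex.normSq_pos.2 hv
  rw [conjPow, conjPow, neg_add, Real.rpow_add h, Real.rpow_neg_one]
  push_cast
  rw [pow_succ]
  have h1 : v * conj v = (Complex.normSq v : ℂ) := Complex.mul_conj v
  have h2 : (Complex.normSq v : ℂ) ≠ 0 := by exact_mod_cast h.ne'
  field_simp
  linear_combination (conj v ^ j * (Complex.normSq v ^ (-σ) : ℝ) : ℂ) * h1

theorem hasDerivAt_conjPow (j : ℕ) (σ : ℝ) (z : ℂ) (u : ℝ) (hv : z + u ≠ 0) :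
    HasDerivAt (fun u : ℝ => conjPow j σ (z + u))
      (j * conjPow (j - 1) σ (z + u) - 2 * σ * (z + u).re * conjPow j (σ + 1) (z + u)) u := by
  have h1 : HasDerivAt (fun u : ℝ => conj (z + u)) 1 u := by
    have : HasDerivAt (fun u : ℝ => conj z + (u : ℂ)) 1 u :=
      (Complex.ofRealCLM.hasDerivAt (x := u)).const_add (conj z) |>.congr_deriv (by simp)
    simpa using this
  have h2 : HasDerivAt (fun u : ℝ => Complex.normSq (z + u)) (2 * (z + u).re) u := by
    have : HasDerivAt (fun u : ℝ => (z.re + u) ^ 2 + z.im ^ 2) (2 * (z.re + u)) u := by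
      simpa using (((hasDerivAt_id u).const_add z.re).pow 2).add_const (z.im ^ 2)
    simpa [Complex.normSq_apply, ← pow_two] using this
  have h3 := (h2.rpow_const (p := -σ) (Or.inl (Complex.normSq_pos.2 hv).ne')).ofReal_comp
  refine ((h1.pow j).mul h3).congr_deriv ?_
  rw [conjPow, conjPow, neg_add', sub_eq_add_neg]
  push_cast
  simp only [Pi.pow_apply]
  ring

theorem norm_deriv_conjPow_le (j : ℕ) {σ : ℝ} (hσ : 0 ≤ σ) {v : ℂ} (hv : v ≠ 0) :
    ‖j * conjPow (j - 1) σ v - 2 * σ * v.re * conjPow j (σ + 1) v‖ ≤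
      (j + 2 * σ) * ‖v‖ ^ (j - 1 - 2 * σ) := by
  have h : 0 < ‖v‖ := norm_pos_iff.2 hv
  rw [add_mul]
  refine (norm_sub_le _ _).trans (add_le_add ?_ ?_)
  · rcases j with _ | j
    · simp
    · rw [norm_mul, norm_conjPow _ _ hv, Complex.norm_natCast]
      push_cast
      simp
  · rw [norm_mul, norm_mul, norm_conjPow _ _ hv, Complex.norm_real,
      show j - 1 - 2 * σ = 1 + (j - 2 * (σ + 1)) by ring, Real.rpow_add h, Real.rpow_one,
      ← mul_assoc]
    gcongr
    · simp [abs_of_nonneg hσ]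
    · exact Complex.abs_re_le_norm v

/-- Euler–Maclaurin type estimate of order two for `u ↦ conj (z + u) |z + u| ^ (-2 (s + 1))`. -/
theorem norm_conjPow_sub_le {y : ℝ} (hy : 0 < y) (hy1 : y ≤ 1) {s : ℝ} (hs : 0 ≤ s) (hs1 : s ≤ 1)
    {z : ℂ} (hz : y ≤ |z.im|) :
    ‖conjPow 1 (s + 1) (z + 1) - conjPow 1 (s + 1) z + s * conjPow 0 (s + 1) z +
      (s + 1) * conjPow 2 (s + 2) z‖ ≤ 160 * y⁻¹ ^ 5 * ‖z‖ ^ (-3 : ℝ) := by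
  have hyv : ∀ u : ℝ, y ≤ ‖z + u‖ := fun u =>
    hz.trans (by simpa using Complex.abs_im_le_norm (z + u))
  have hv0 : ∀ u : ℝ, z + u ≠ 0 := fun u => norm_pos_iff.1 (hy.trans_le (hyv u))
  have hz0 : 0 < ‖z‖ := by simpa using hy.trans_le (hyv 0)
  -- The u-derivative of v̄ |v|^(−2(s+1)) at v = z + u, simplified by 2 Re v = v + v̄.
  set G : ℝ → ℂ := fun u => -(s * conjPow 0 (s + 1) (z + u)) -
    (s + 1) * conjPow 2 (s + 2) (z + u) with hG
  have hg : ∀ u : ℝ, HasDerivAt (fun u : ℝ => conjPow 1 (s + 1) (z + u)) (G u) u := by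
    intro u
    refine (hasDerivAt_conjPow 1 (s + 1) z u (hv0 u)).congr_deriv ?_
    have h1 := mul_conjPow_succ 0 (s + 1) (hv0 u)
    have h2 := conj_mul_conjPow 1 (s + 2) (z + u)
    have h3 : (2 * (z + u).re : ℂ) = (z + u) + conj (z + u) := by
      rw [Complex.add_conj]; push_cast; ring
    rw [show s + 1 + 1 = s + 2 by ring] at h1 ⊢
    simp only [hG]
    push_cast
    simp only [zero_add] at h1
    linear_combination (-(s + 1) * conjPow 1 (s + 2) (z + u) : ℂ) * h3 - (s + 1 : ℂ) * h1 -
      (s + 1 : ℂ) * h2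
  -- 160 = 20 · 8: the coefficients of the second derivative add up to at most 20 for s ≤ 1, and |z|
  -- ≤ 2y⁻¹|z + u| gives 8y⁻³|z|⁻³. A further y⁻² bounds |z + u|^(−2s).
  set K : ℝ := 160 * y⁻¹ ^ 5 * ‖z‖ ^ (-3 : ℝ) with hK
  have hK0 : 0 ≤ K := by positivity
  have hG' : ∀ u : ℝ, ∃ D : ℂ, HasDerivAt G D u ∧ (u ∈ Set.Icc (0 : ℝ) 1 → ‖D‖ ≤ K) := by
    intro u
    refine ⟨_, (((hasDerivAt_conjPow 0 (s + 1) z u (hv0 u)).const_mul (s : ℂ)).neg.sub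
      ((hasDerivAt_conjPow 2 (s + 2) z u (hv0 u)).const_mul (s + 1 : ℂ))), fun hu => ?_⟩
    have hv : 0 < ‖z + u‖ := norm_pos_iff.2 (hv0 u)
    have b0 := norm_deriv_conjPow_le 0 (σ := s + 1) (by positivity) (hv0 u)
    have b2 := norm_deriv_conjPow_le 2 (σ := s + 2) (by positivity) (hv0 u)
    rw [show ((0 : ℕ) : ℝ) - 1 - 2 * (s + 1) = -3 + -(2 * s) by push_cast; ring] at b0
    rw [show ((2 : ℕ) : ℝ) - 1 - 2 * (s + 2) = -3 + -(2 * s) by push_cast; ring] at b2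
    have hb1 : ‖z + u‖ ^ (-3 : ℝ) ≤ (2 * y⁻¹) ^ 3 * ‖z‖ ^ (-3 : ℝ) := by
      have h1 : ‖z‖ ≤ 2 * y⁻¹ * ‖z + u‖ := by
        have h2 : ‖z‖ ≤ ‖z + u‖ + 1 := by
          have := norm_sub_le (z + u) u
          rw [add_sub_cancel_right, Complex.norm_real, Real.norm_of_nonneg hu.1] at this
          linarith [hu.2]
        have h3 : 1 ≤ y⁻¹ * ‖z + u‖ := by
          rw [inv_mul_eq_div, one_le_div hy]; exact hyv u
        have h4 : ‖z + u‖ ≤ y⁻¹ * ‖z + u‖ :=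
          le_mul_of_one_le_left hv.le ((one_le_inv₀ hy).2 hy1)
        linarith
      have e : ∀ x : ℝ, 0 ≤ x → x ^ (-3 : ℝ) = (x ^ 3)⁻¹ := fun x hx => by
        rw [Real.rpow_neg hx]; norm_cast
      rw [e _ hv.le, e _ hz0.le, ← div_eq_mul_inv, le_div_iff₀ (by positivity),
        inv_mul_le_iff₀ (by positivity), ← mul_pow, mul_comm]
      gcongr
    have hb2 : ‖z + u‖ ^ (-(2 * s)) ≤ y⁻¹ ^ 2 := by
      calc ‖z + u‖ ^ (-(2 * s)) ≤ y ^ (-(2 * s)) :=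
            Real.rpow_le_rpow_of_nonpos hy (hyv u) (by linarith)
        _ ≤ y ^ (-2 : ℝ) := Real.rpow_le_rpow_of_exponent_ge hy hy1 (by linarith)
        _ = y⁻¹ ^ 2 := by rw [Real.rpow_neg hy.le, inv_pow]; norm_cast
    have hb : ‖z + u‖ ^ (-3 + -(2 * s)) ≤ 8 * y⁻¹ ^ 5 * ‖z‖ ^ (-3 : ℝ) := by
      rw [Real.rpow_add hv]
      refine (mul_le_mul hb1 hb2 (by positivity) (by positivity)).trans (le_of_eq ?_)
      ring
    set R := ‖z + u‖ ^ (-3 + -(2 * s)) with hR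
    have hR0 : 0 ≤ R := by positivity
    refine (norm_sub_le _ _).trans ?_
    rw [norm_neg, norm_mul, norm_mul, Complex.norm_real, Real.norm_of_nonneg hs,
      show (s + 1 : ℂ) = ((s + 1 : ℝ) : ℂ) by push_cast; rfl, Complex.norm_real,
      Real.norm_of_nonneg (by positivity : 0 ≤ s + 1)]
    have e0 := mul_le_mul_of_nonneg_left b0 hs
    have e2 := mul_le_mul_of_nonneg_left b2 (by positivity : 0 ≤ s + 1)
    refine (add_le_add e0 e2).trans ?_
    push_cast
    have e3 : s * ((0 + 2 * (s + 1)) * R) + (s + 1) * ((2 + 2 * (s + 2)) * R) ≤ 20 * R := by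
      have : s * (2 * (s + 1)) + (s + 1) * (2 + 2 * (s + 2)) ≤ 20 := by nlinarith
      nlinarith [mul_le_mul_of_nonneg_right this hR0]
    rw [hK]
    linarith
  have hGb : ∀ u ∈ Set.Icc (0 : ℝ) 1, ‖G u - G 0‖ ≤ K := by
    intro u hu
    choose D hD hDK using hG'
    have := norm_image_sub_le_of_norm_deriv_le_segment' (f := G) (f' := D) (C := K) (a := 0)
      (b := 1)
      (fun x _ => (hD x).hasDerivWithinAt) (fun x hx => hDK x ⟨hx.1, hx.2.le⟩) u hu
    refine this.trans ?_
    nlinarith [hu.1, hu.2]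
  -- The mean value inequality for the first order Taylor remainder, whose derivative is G u − G 0.
  have hfin := norm_image_sub_le_of_norm_deriv_le_segment_01'
    (f := fun u : ℝ => conjPow 1 (s + 1) (z + u) - u * G 0) (f' := fun u => G u - G 0) (C := K)
    (fun u _ => ((hg u).sub (((Complex.ofRealCLM.hasDerivAt (x := u)).mul_const (G 0)).congr_deriv
      (by simp))).hasDerivWithinAt) (fun u hu => hGb u ⟨hu.1, hu.2.le⟩)
  refine le_trans (le_of_eq ?_) hfin
  congr 1
  simp only [hG, Complex.ofReal_zero, Complex.ofReal_one, add_zero]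
  ring

/-- The sum over −N ≤ n < N telescopes to a(N) − a(−N), which tends to 0. -/
theorem tsum_int_sub_eq_zero {a : ℤ → ℂ} (ha : Tendsto a cofinite (𝓝 0))
    (hs : Summable fun n => a (n + 1) - a n) : ∑' n, (a (n + 1) - a n) = 0 := by
  have h1 := hs.hasSum.comp Finset.tendsto_Ico_neg
  have h2 : Tendsto (fun N : ℕ => a N - a (-N)) atTop (𝓝 0) := by
    rw [Int.cofinite_eq, tendsto_sup] at ha
    simpa using (ha.2.comp tendsto_natCast_atTop_atTop).sub
      (ha.1.comp (tendsto_neg_atTop_atBot.comp tendsto_natCast_atTop_atTop))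
  refine tendsto_nhds_unique h1 (h2.congr fun N => ?_)
  have h3 := Finset.sum_Ico_int_sub N a
  simp only [Function.comp]
  rw [← neg_inj, ← Finset.sum_neg_distrib]
  simpa using h3.symm

theorem tendsto_latticePoint_inv (τ : ℍ) (m : ℤ) :
    Tendsto (fun n : ℤ => ‖latticePoint τ (m, n)‖⁻¹) cofinite (𝓝 0) := by
  have h : Tendsto (fun n : ℤ => (n : ℝ)⁻¹) cofinite (𝓝 0) :=
    tendsto_zero_iff_norm_tendsto_zero.2 (by
      simpa [Function.comp_def] using! tendsto_inv_atTop_zero.comp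
        (tendsto_norm_comp_cofinite_atTop_of_isClosedEmbedding Int.isClosedEmbedding_coe_real))
  simpa [latticePoint] using
    ((EisensteinSeries.linear_inv_isBigO_right m τ).trans_tendsto h).norm

theorem epsteinTerm_two_eq (τ : ℍ) (s : ℝ) {p : ℤ × ℤ} (hp : p ≠ 0) :
    epsteinTerm 2 τ (s + 2) p = conjPow 2 (s + 2) (latticePoint τ p) := by
  have h := norm_latticePoint_pos τ hp
  rw [epsteinTerm, latticeCoeff, if_neg hp, conjPow, Complex.normSq_eq_norm_sq,
    ← Real.rpow_natCast_mul h.le, Complex.ofReal_cpow h.le]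
  push_cast
  ring_nf

theorem epsteinTerm_zero_eq (τ : ℍ) (s : ℝ) {p : ℤ × ℤ} (hp : p ≠ 0) :
    epsteinTerm 0 τ (s + 1) p = conjPow 0 (s + 1) (latticePoint τ p) := by
  have h := norm_latticePoint_pos τ hp
  rw [epsteinTerm, latticeCoeff, if_neg hp, conjPow, Complex.normSq_eq_norm_sq,
    ← Real.rpow_natCast_mul h.le, Complex.ofReal_cpow h.le]
  push_cast
  ring_nf

/-- The forward difference, in the second variable, of `conj v |v| ^ (-2 (s + 1))`. -/
noncomputable def rowDiff (τ : ℍ) (s : ℝ) (p : ℤ × ℤ) : ℂ :=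
  if p.1 = 0 then 0 else
    conjPow 1 (s + 1) (latticePoint τ (p.1, p.2 + 1)) - conjPow 1 (s + 1) (latticePoint τ p)

/-- Telescoping, since v̄ |v|^(−2(s+1)) tends to 0 along a row. Row 0 passes through the origin, and
there the differences are set to 0. -/
theorem tsum_row_rowDiff (τ : ℍ) {s : ℝ} (hs : 0 ≤ s) (m : ℤ)
    (h : Summable fun n => rowDiff τ s (m, n)) : ∑' n, rowDiff τ s (m, n) = 0 := by
  by_cases hm : m = 0
  · simp [rowDiff, hm]
  simp only [rowDiff, if_neg hm] at h ⊢
  refine tsum_int_sub_eq_zero (a := fun n => conjPow 1 (s + 1) (latticePoint τ (m, n))) ?_ h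
  refine squeeze_zero_norm' ?_ (tendsto_latticePoint_inv τ m)
  have h1 := (tendsto_latticePoint_inv τ m).eventually (gt_mem_nhds one_pos)
  filter_upwards [h1] with n hn
  have hp : (m, n) ≠ 0 := by simp [Prod.ext_iff, hm]
  have hv := norm_latticePoint_pos τ hp
  rw [norm_conjPow _ _ (latticePoint_ne_zero τ hp), ← Real.rpow_neg_one]
  refine Real.rpow_le_rpow_of_exponent_le ((inv_lt_one₀ hv).1 hn).le ?_
  push_cast
  linarith

/-- The summand of the Eisenstein series of weight two, modified so that its sum converges
absolutely and uniformly for `s` near `0`. -/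
noncomputable def heckeTerm (τ : ℍ) (s : ℝ) (p : ℤ × ℤ) : ℂ :=
  epsteinTerm 2 τ (s + 2) p + s / (s + 1) * epsteinTerm 0 τ (s + 1) p +
    1 / (s + 1) * rowDiff τ s p

/-- Off row 0 the term is 1/(s + 1) times the remainder of `norm_conjPow_sub_le`, hence O(|v|⁻³)
uniformly in s. On row 0 each of the two zeta terms is at most n⁻². -/
theorem norm_heckeTerm_le (τ : ℍ) : ∃ C : ℝ, ∀ s : ℝ, 0 ≤ s → s ≤ 1 → ∀ p : ℤ × ℤ,
    ‖heckeTerm τ s p‖ ≤ C * ‖latticePoint τ p‖ ^ (-3 : ℝ) +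
      if p.1 = 0 then 2 * (|(p.2 : ℝ)| ^ 2)⁻¹ else 0 := by
  set y := min τ.im 1 with hy
  have hy0 : 0 < y := lt_min τ.im_pos one_pos
  refine ⟨160 * y⁻¹ ^ 5, fun s hs hs1 p => ?_⟩
  have hs' : ((s : ℂ) + 1) ≠ 0 := by exact_mod_cast (by linarith : s + 1 ≠ 0)
  by_cases hp : p = 0
  · simp [heckeTerm, epsteinTerm, latticeCoeff, rowDiff, hp]
  have hv := latticePoint_ne_zero τ hp
  rw [heckeTerm, epsteinTerm_two_eq τ s hp, epsteinTerm_zero_eq τ s hp, rowDiff]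
  split_ifs with h
  · rw [mul_zero, add_zero]
    refine le_trans ?_ (le_add_of_nonneg_left (by positivity))
    have hlp : latticePoint τ p = (p.2 : ℂ) := by simp [latticePoint, h]
    have hn : 1 ≤ ‖latticePoint τ p‖ := by
      have : p.2 ≠ 0 := fun h2 => hp (Prod.ext h h2)
      rw [hlp, Complex.norm_intCast]
      exact_mod_cast Int.one_le_abs this
    have hb : ∀ (j : ℕ) (σ : ℝ), j - 2 * σ ≤ -2 → ‖conjPow j σ (latticePoint τ p)‖ ≤
        (|(p.2 : ℝ)| ^ 2)⁻¹ := by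
      intro j σ hj
      rw [norm_conjPow _ _ hv]
      refine (Real.rpow_le_rpow_of_exponent_le hn hj).trans (le_of_eq ?_)
      rw [Real.rpow_neg (norm_nonneg _), hlp, Complex.norm_intCast]
      norm_cast
    have h1 := hb 2 (s + 2) (by push_cast; linarith)
    have h2 := hb 0 (s + 1) (by push_cast; linarith)
    have h3 : ‖(s / (s + 1) : ℂ)‖ ≤ 1 := by
      rw [show (s / (s + 1) : ℂ) = ((s / (s + 1) : ℝ) : ℂ) by push_cast; rfl, Complex.norm_real,
        Real.norm_of_nonneg (by positivity), div_le_one (by positivity)]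
      linarith
    refine (norm_add_le _ _).trans ?_
    rw [norm_mul, two_mul]
    gcongr
    exact (mul_le_of_le_one_left (norm_nonneg _) h3).trans h2
  · rw [add_zero]
    have hz : y ≤ |(latticePoint τ p).im| := by
      rw [latticePoint_im, abs_mul, abs_of_pos τ.im_pos]
      have : (1 : ℝ) ≤ |(p.1 : ℝ)| := by exact_mod_cast Int.one_le_abs h
      exact (min_le_left _ _).trans (le_mul_of_one_le_left τ.im_pos.le this)
    have hmain := norm_conjPow_sub_le hy0 (min_le_right _ _) hs hs1 hz
    have e1 : latticePoint τ (p.1, p.2 + 1) = latticePoint τ p + 1 := by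
      simp [latticePoint, add_assoc]
    rw [e1]
    have e2 : ∀ A B Z W : ℂ, W + s / (s + 1) * Z + 1 / (s + 1) * (A - B) =
        (1 / (s + 1)) * (A - B + s * Z + (s + 1) * W) := by
      intro A B Z W
      field_simp
      ring
    rw [e2, norm_mul]
    refine (mul_le_of_le_one_left (norm_nonneg _) ?_).trans hmain
    rw [show (1 / (s + 1) : ℂ) = ((1 / (s + 1) : ℝ) : ℂ) by push_cast; rfl, Complex.norm_real,
      Real.norm_of_nonneg (by positivity), div_le_one (by positivity)]
    linarith

theorem summable_heckeTerm_bound (τ : ℍ) (C : ℝ) :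
    Summable fun p : ℤ × ℤ => C * ‖latticePoint τ p‖ ^ (-3 : ℝ) +
      if p.1 = 0 then 2 * (|(p.2 : ℝ)| ^ 2)⁻¹ else 0 := by
  refine ((summable_norm_latticePoint_rpow τ (k := 3) (by norm_num)).mul_left C).add ?_
  have hinj : Function.Injective fun n : ℤ => ((0, n) : ℤ × ℤ) := fun a b h => by simpa using h
  refine (hinj.summable_iff ?_).1 ?_
  · rintro ⟨m, n⟩ hmn
    have : m ≠ 0 := by rintro rfl; exact hmn ⟨n, rfl⟩
    simp [this]
  · have := (Real.summable_abs_int_rpow (b := 2) one_lt_two).mul_left 2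
    refine this.congr fun n => ?_
    simp only [Function.comp, if_pos]
    rw [Real.rpow_neg (abs_nonneg _)]
    norm_cast

theorem summable_heckeTerm (τ : ℍ) {s : ℝ} (hs : 0 ≤ s) (hs1 : s ≤ 1) :
    Summable (heckeTerm τ s) := by
  obtain ⟨C, hC⟩ := norm_heckeTerm_le τ
  exact (summable_heckeTerm_bound τ C).of_norm_bounded (hC s hs hs1)

/-- For s > 0 the pieces converge separately, and the differences sum to 0 row by row. -/
theorem tsum_heckeTerm (τ : ℍ) {s : ℝ} (hs : 0 < s) (hs1 : s ≤ 1) :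
    ∑' p, heckeTerm τ s p = ∑' p, epsteinTerm 2 τ (s + 2) p +
      s / (s + 1) * ∑' p, epsteinTerm 0 τ (s + 1) p := by
  have hs' : ((s : ℂ) + 1) ≠ 0 := by exact_mod_cast (by linarith : s + 1 ≠ 0)
  have h2 : Summable (epsteinTerm 2 τ (s + 2)) := summable_epsteinTerm τ (by simp; linarith)
  have h0 : Summable (epsteinTerm 0 τ (s + 1)) := summable_epsteinTerm τ (by simp; linarith)
  have hh := summable_heckeTerm τ hs.le hs1
  have hd : Summable (rowDiff τ s) := by
    refine (((hh.sub h2).sub (h0.mul_left (s / (s + 1) : ℂ))).mul_left (s + 1 : ℂ)).congr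
      fun p => ?_
    rw [heckeTerm]
    field_simp
    ring
  have hz : ∑' p, rowDiff τ s p = 0 := by
    rw [hd.tsum_prod]
    simp_rw [fun m => tsum_row_rowDiff τ hs.le m (hd.prod_factor m), tsum_zero]
  simp only [heckeTerm]
  rw [(h2.add (h0.mul_left _)).tsum_add (hd.mul_left _), h2.tsum_add (h0.mul_left _), tsum_mul_left,
    tsum_mul_left, hz, mul_zero, add_zero]

/-- Absolute convergence allows summation row by row. The differences drop out of each row, leaving
∑ v⁻² in the order of summation that defines `G2`. -/
theorem tsum_heckeTerm_zero (τ : ℍ) : ∑' p, heckeTerm τ 0 p = EisensteinSeries.G2 τ := by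
  have hh := summable_heckeTerm τ le_rfl zero_le_one
  have heis : ∀ m n : ℤ, epsteinTerm 2 τ ((0 : ℝ) + 2) (m, n) =
      EisensteinSeries.eisSummand 2 ![m, n] τ := by
    intro m n
    by_cases hp : (m, n) = 0
    · obtain ⟨rfl, rfl⟩ := Prod.ext_iff.1 hp
      simp [epsteinTerm, latticeCoeff, EisensteinSeries.eisSummand]
    · rw [epsteinTerm_two_eq τ 0 hp, conjPow, EisensteinSeries.eisSummand]
      have hv := latticePoint_ne_zero τ hp
      have hc : conj (latticePoint τ (m, n)) ≠ 0 := by simpa using hv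
      have h1 : Complex.normSq (latticePoint τ (m, n)) ^ (-(0 + 2) : ℝ) =
          (Complex.normSq (latticePoint τ (m, n)) ^ 2)⁻¹ := by
        rw [zero_add, Real.rpow_neg (Complex.normSq_nonneg _)]
        norm_cast
      rw [h1]
      push_cast
      rw [← Complex.mul_conj]
      change _ = latticePoint τ (m, n) ^ (-2 : ℤ)
      field_simp
  have hrow : ∀ m : ℤ, ∑' n : ℤ, heckeTerm τ 0 (m, n) = EisensteinSeries.e2Summand m τ := by
    intro m
    have h1 := EisensteinSeries.e2Summand_summable m τ
    have h2 : ∀ n, heckeTerm τ 0 (m, n) =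
        EisensteinSeries.eisSummand 2 ![m, n] τ + rowDiff τ 0 (m, n) := by
      intro n
      rw [heckeTerm, heis]
      simp
    have h3 : Summable fun n => rowDiff τ 0 (m, n) :=
      ((hh.prod_factor m).sub h1).congr fun n => by rw [h2]; ring
    simp_rw [h2]
    rw [h1.tsum_add h3, tsum_row_rowDiff τ le_rfl m h3, add_zero, EisensteinSeries.e2Summand]
  have h := hh.hasSum.prod_fiberwise fun m => (hh.prod_factor m).hasSum
  simp only [hrow] at h
  have h' : HasSum (fun m => EisensteinSeries.e2Summand m τ) (∑' p, heckeTerm τ 0 p)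
      (SummationFilter.symmetricIcc ℤ) := by
    rw [SummationFilter.hasSum_symmetricIcc_iff]
    exact h.comp Finset.tendsto_Icc_neg
  exact h'.tsum_eq.symm

theorem continuousAt_conjPow (j : ℕ) (σ : ℝ) {v : ℂ} (hv : v ≠ 0) :
    Continuous fun s : ℝ => conjPow j (s + σ) v := by
  have h : 0 < Complex.normSq v := Complex.normSq_pos.2 hv
  unfold conjPow
  refine continuous_const.mul (Complex.continuous_ofReal.comp ?_)
  exact Continuous.rpow continuous_const (by fun_prop) fun _ => Or.inl h.ne'

theorem tendsto_heckeTerm (τ : ℍ) (p : ℤ × ℤ) :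
    Tendsto (fun s => heckeTerm τ s p) (𝓝[>] 0) (𝓝 (heckeTerm τ 0 p)) := by
  by_cases hp : p = 0
  · simp [heckeTerm, epsteinTerm, latticeCoeff, rowDiff, hp]
  have hv := latticePoint_ne_zero τ hp
  have hc : ContinuousAt (fun s => heckeTerm τ s p) 0 := by
    have h1 : ContinuousAt (fun s => rowDiff τ s p) 0 := by
      unfold rowDiff
      split_ifs with h
      · exact continuousAt_const
      · have hp' : (p.1, p.2 + 1) ≠ 0 := by simp [Prod.ext_iff, h]
        exact ((continuousAt_conjPow 1 1 (latticePoint_ne_zero τ hp')).sub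
          (continuousAt_conjPow 1 1 hv)).continuousAt
    have e : ContinuousAt (fun s : ℝ => (s : ℂ) + 1) 0 := by fun_prop
    have e' : ((0 : ℝ) : ℂ) + 1 ≠ 0 := by simp
    simp only [heckeTerm, epsteinTerm_two_eq τ _ hp, epsteinTerm_zero_eq τ _ hp]
    exact ((continuousAt_conjPow 2 2 hv).continuousAt.add
      ((Complex.continuous_ofReal.continuousAt.div e e').mul
      (continuousAt_conjPow 0 1 hv).continuousAt)).add ((continuousAt_const.div e e').mul h1)
  exact hc.tendsto.mono_left nhdsWithin_le_nhds

theorem tendsto_tsum_heckeTerm (τ : ℍ) :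
    Tendsto (fun s => ∑' p, heckeTerm τ s p) (𝓝[>] 0) (𝓝 (EisensteinSeries.G2 τ)) := by
  rw [← tsum_heckeTerm_zero]
  obtain ⟨C, hC⟩ := norm_heckeTerm_le τ
  refine tendsto_tsum_of_dominated_convergence (summable_heckeTerm_bound τ C)
    (tendsto_heckeTerm τ) ?_
  filter_upwards [Ioc_mem_nhdsGT one_pos] with s hs using hC s hs.1.le hs.2

/-- The origin of the nonholomorphic term: the factor s meets the simple pole of the Epstein zeta
function at 1. Its residue is π/y, because (s − 1)Λ(s) → 1 and Γ(s)(y/π)^s → y/π. -/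
theorem tendsto_mul_tsum_epsteinTerm_zero (τ : ℍ) :
    Tendsto (fun s : ℝ => (s / (s + 1) : ℂ) * ∑' p, epsteinTerm 0 τ (s + 1) p) (𝓝[>] 0)
      (𝓝 (Real.pi / τ.im)) := by
  have hy : (τ.im : ℂ) ≠ 0 := by exact_mod_cast τ.im_pos.ne'
  have hπ := Complex.ofReal_ne_zero.2 Real.pi_ne_zero
  have hq : (τ.im / Real.pi : ℂ) ≠ 0 := div_ne_zero hy hπ
  have h1 : Tendsto (fun s : ℝ => (s : ℂ) + 1) (𝓝[>] 0) (𝓝[≠] 1) := by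
    refine tendsto_nhdsWithin_iff.2 ⟨?_, ?_⟩
    · have : Continuous fun s : ℝ => (s : ℂ) + 1 := by fun_prop
      simpa using (this.tendsto 0).mono_left nhdsWithin_le_nhds
    · filter_upwards [self_mem_nhdsWithin] with s hs
      have : (s : ℂ) ≠ 0 := by exact_mod_cast (ne_of_gt hs)
      simpa using this
  have h2 : Tendsto (fun s => (s - 1) * (thetaPair τ).Λ s) (𝓝[≠] 1) (𝓝 1) := by
    simpa [thetaPair] using (thetaPair τ).Λ_residue_k
  have h3 : ContinuousAt (fun s : ℂ => s * (Complex.Gamma s * (τ.im / Real.pi) ^ s)) 1 := by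
    refine continuousAt_id.mul (ContinuousAt.mul ?_ ?_)
    · exact (Complex.differentiableAt_Gamma_one).continuousAt
    · exact continuousAt_const_cpow hq
  have h4 : ((1 : ℂ) * (Complex.Gamma 1 * (τ.im / Real.pi : ℂ) ^ (1 : ℂ))) ≠ 0 := by
    simpa using hq
  have h5 := (h2.div (h3.tendsto.mono_left nhdsWithin_le_nhds) h4).comp h1
  have h6 : (1 / ((1 : ℂ) * (Complex.Gamma 1 * (τ.im / Real.pi : ℂ) ^ (1 : ℂ)))) =
      Real.pi / τ.im := by simp
  rw [h6] at h5
  refine h5.congr' ?_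
  filter_upwards [self_mem_nhdsWithin] with s (hs : 0 < s)
  have hs' : ((s : ℂ) + 1) ≠ 0 := by exact_mod_cast (by linarith : s + 1 ≠ 0)
  have hG : Complex.Gamma (s + 1) ≠ 0 := Complex.Gamma_ne_zero_of_re_pos (by simp; linarith)
  have hc : (τ.im / Real.pi : ℂ) ^ (s + 1 : ℂ) ≠ 0 := by simp [Complex.cpow_eq_zero_iff, hy, hπ]
  simp only [Function.comp, Pi.div_apply]
  rw [Λ_thetaPair τ (by simpa using hs)]
  generalize (τ.im / Real.pi : ℂ) ^ (s + 1 : ℂ) = A at hc ⊢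
  field_simp
  ring

/-- Hecke's limit formula for the Eisenstein series of weight two. -/
theorem tendsto_tsum_epsteinTerm_two (τ : ℍ) :
    Tendsto (fun s : ℝ => ∑' p, epsteinTerm 2 τ (s + 2) p) (𝓝[>] 0)
      (𝓝 (EisensteinSeries.G2 τ - Real.pi / τ.im)) := by
  refine ((tendsto_tsum_heckeTerm τ).sub (tendsto_mul_tsum_epsteinTerm_zero τ)).congr' ?_
  filter_upwards [Ioc_mem_nhdsGT one_pos] with s hs
  rw [tsum_heckeTerm τ hs.1 hs.2, add_sub_cancel_right]

/-! ### Cosets, coprime pairs and the zeta factor. -/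

theorem mem_GammaInf_of_bottom_row {g : SL(2, ℤ)} (h0 : g 1 0 = 0) (h1 : g 1 1 = 1) :
    g ∈ GammaInf := by
  refine ⟨g 0 1, Or.inl ?_⟩
  have hdet := g.det_coe
  rw [Matrix.det_fin_two, h0, h1] at hdet
  ext i j
  rw [ModularGroup.coe_T_zpow]
  fin_cases i <;> fin_cases j <;> simp [h0, h1]
  linarith

/-- As det δ = 1, the bottom row of γδ⁻¹ is (0, u). -/
theorem mul_inv_mem_GammaInf {γ δ : SL(2, ℤ)} (u : ℤˣ) (h0 : γ 1 0 = u * δ 1 0)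
    (h1 : γ 1 1 = u * δ 1 1) : γ * δ⁻¹ ∈ GammaInf := by
  have hdet := δ.det_coe
  rw [Matrix.det_fin_two] at hdet
  have e0 : (γ * δ⁻¹) 1 0 = 0 := by
    simp [Matrix.SpecialLinearGroup.coe_mul, Matrix.mul_apply, Matrix.SpecialLinearGroup.coe_inv,
      Matrix.adjugate_fin_two, h0, h1]
    ring
  have e1 : (γ * δ⁻¹) 1 1 = u := by
    simp [Matrix.SpecialLinearGroup.coe_mul, Matrix.mul_apply, Matrix.SpecialLinearGroup.coe_inv,
      Matrix.adjugate_fin_two, h0, h1]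
    linear_combination (u : ℤ) * hdet
  rcases Int.units_eq_one_or u with rfl | rfl
  · exact mem_GammaInf_of_bottom_row e0 e1
  · have h := mem_GammaInf_of_bottom_row (g := -(γ * δ⁻¹)) (neg_eq_zero.2 e0)
      (neg_eq_iff_eq_neg.2 e1)
    obtain ⟨n, hn | hn⟩ := h
    · exact ⟨n, Or.inr (by rw [← hn, neg_neg])⟩
    · exact ⟨n, Or.inl (neg_injective hn)⟩

theorem exists_bottom_row_eq_of_mul_inv_mem {γ δ : SL(2, ℤ)} (h : γ * δ⁻¹ ∈ GammaInf) :
    ∃ u : ℤˣ, γ 1 0 = u * δ 1 0 ∧ γ 1 1 = u * δ 1 1 := by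
  obtain ⟨n, hn | hn⟩ := h
  · refine ⟨1, ?_⟩
    rw [mul_inv_eq_iff_eq_mul.1 hn]
    simp
  · refine ⟨-1, ?_⟩
    rw [mul_inv_eq_iff_eq_mul.1 hn]
    have h10 : (ModularGroup.T ^ n * δ) 1 0 = δ 1 0 := by simp
    have h11 : (ModularGroup.T ^ n * δ) 1 1 = δ 1 1 := by simp
    rw [neg_mul]
    rw [Units.val_neg, Units.val_one, neg_one_mul, neg_one_mul]
    exact ⟨congrArg Neg.neg h10, congrArg Neg.neg h11⟩

/-- The bottom row of a representative of a coset in `Γ_∞ \ SL(2, ℤ)`. -/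
noncomputable def bottomRow (q : Cosets) : ℤ × ℤ := (q.out 1 0, q.out 1 1)

theorem isCoprime_bottomRow (q : Cosets) : IsCoprime (bottomRow q).1 (bottomRow q).2 :=
  ModularGroup.bottom_row_coprime q.out

theorem bottomRow_ne_zero (q : Cosets) : bottomRow q ≠ 0 := by
  intro h
  have := isCoprime_bottomRow q
  rw [h] at this
  exact not_isCoprime_zero_zero this

theorem eq_of_bottomRow_eq_smul {q q' : Cosets} (u : ℤˣ) (h : bottomRow q = u • bottomRow q') :
    q = q' := by
  rw [← q.out_eq, ← q'.out_eq]
  refine Quotient.sound ((QuotientGroup.rightRel_apply).2 ?_)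
  rw [Prod.ext_iff] at h
  rw [← GammaInf.inv_mem_iff, mul_inv_rev, inv_inv]
  exact mul_inv_mem_GammaInf u (by simpa [bottomRow, Units.smul_def] using h.1)
    (by simpa [bottomRow, Units.smul_def] using h.2)

theorem exists_bottomRow_eq {p : ℤ × ℤ} (hp : IsCoprime p.1 p.2) :
    ∃ (q : Cosets) (u : ℤˣ), p = u • bottomRow q := by
  obtain ⟨γ, -, hγ⟩ := ModularGroup.bottom_row_surj (R := ℤ)
    (show ![p.1, p.2] ∈ {cd : Fin 2 → ℤ | IsCoprime (cd 0) (cd 1)} by simpa using hp)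
  set q : Cosets := Quotient.mk _ γ with hq
  have h1 : γ * q.out⁻¹ ∈ GammaInf :=
    QuotientGroup.rightRel_apply.1 (Quotient.exact (q.out_eq.trans hq))
  obtain ⟨u, h0, h1⟩ := exists_bottom_row_eq_of_mul_inv_mem h1
  have e0 : γ 1 0 = p.1 := congrFun hγ 0
  have e1 : γ 1 1 = p.2 := congrFun hγ 1
  refine ⟨q, u, Prod.ext ?_ ?_⟩
  · simpa [bottomRow, Units.smul_def, e0] using h0
  · simpa [bottomRow, Units.smul_def, e1] using h1

/-- Every nonzero lattice point is, up to sign, a unique positive multiple of the bottom row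
of a unique coset. -/
noncomputable def latticeEquiv : ℕ+ × (Cosets × ℤˣ) ≃ {p : ℤ × ℤ // p ≠ 0} :=
  Equiv.ofBijective (fun x => ⟨(x.1 : ℕ) • x.2.2 • bottomRow x.2.1, by
    rw [smul_ne_zero_iff]
    refine ⟨x.1.ne_zero, fun h => bottomRow_ne_zero x.2.1 ?_⟩
    rwa [smul_eq_zero_iff_eq] at h⟩) <| by
  -- The multiple N is recovered as the gcd of the two coordinates, because bottom rows are coprime.
  have hgcd : ∀ (N : ℕ) (q : Cosets) (u : ℤˣ),
      Int.gcd (N • u • bottomRow q).1 (N • u • bottomRow q).2 = N := by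
    intro N q u
    have h := Int.isCoprime_iff_gcd_eq_one.1 (isCoprime_bottomRow q)
    rcases Int.units_eq_one_or u with rfl | rfl
    · simp [Int.gcd_mul_left, h]
    · simp [Int.gcd_mul_left, h]
  constructor
  · rintro ⟨N, q, u⟩ ⟨N', q', u'⟩ h
    have h : (N : ℕ) • u • bottomRow q = (N' : ℕ) • u' • bottomRow q' := congrArg Subtype.val h
    have hN : N = N' := PNat.coe_injective (by
      show (N : ℕ) = N'
      rw [← hgcd N q u, h, hgcd])
    subst hN
    have h2 := smul_right_injective (ℤ × ℤ) N.ne_zero h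
    have hq : q = q' := eq_of_bottomRow_eq_smul (u⁻¹ * u') (by
      rw [mul_smul, ← h2, inv_smul_smul])
    subst hq
    have hu : u = u' := by
      have h3 : ((u : ℤ) - u') • bottomRow q = 0 := by
        rw [sub_smul, sub_eq_zero]; exact h2
      rw [smul_eq_zero] at h3
      exact Units.ext (sub_eq_zero.1 (h3.resolve_right (bottomRow_ne_zero q)))
    rw [hu]
  · rintro ⟨p, hp⟩
    have hg : 0 < Int.gcd p.1 p.2 := by
      rw [Int.gcd_pos_iff]
      by_contra! h
      exact hp (Prod.ext h.1 h.2)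
    obtain ⟨a, b, hab, h1, h2⟩ := Int.exists_gcd_one hg
    obtain ⟨q, u, hqu⟩ := exists_bottomRow_eq (p := (a, b)) (Int.isCoprime_iff_gcd_eq_one.2 hab)
    refine ⟨(⟨Int.gcd p.1 p.2, hg⟩, q, u), Subtype.ext ?_⟩
    simp only [← hqu, PNat.mk_coe]
    refine Prod.ext ?_ ?_
    · simp only [Prod.smul_mk, nsmul_eq_mul]
      rw [mul_comm]; exact h1.symm
    · simp only [Prod.smul_mk, nsmul_eq_mul]
      rw [mul_comm]; exact h2.symm

theorem latticeEquiv_apply (N : ℕ+) (q : Cosets) (u : ℤˣ) :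
    (latticeEquiv (N, q, u) : ℤ × ℤ) = (N : ℕ) • u • bottomRow q := rfl

/-- v̄^j |v|^(−2s) is homogeneous of degree j − 2s under positive scaling. Evenness of j removes the
sign, and with it the choice of coset representative. -/
theorem epsteinTerm_latticeEquiv {j : ℕ} (hj : Even j) (τ : ℍ) (s : ℂ) (x : ℕ+ × (Cosets × ℤˣ)) :
    epsteinTerm j τ s (latticeEquiv x) =
      1 / (x.1 : ℂ) ^ (2 * s - j) * epsteinTerm j τ s (bottomRow x.2.1) := by
  obtain ⟨N, q, u⟩ := x
  have hp : (latticeEquiv (N, q, u) : ℤ × ℤ) ≠ 0 := (latticeEquiv (N, q, u)).2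
  have hN : (N : ℂ) ≠ 0 := by exact_mod_cast N.ne_zero
  have hlp : latticePoint τ (latticeEquiv (N, q, u)) =
      (N : ℂ) * ((u : ℤ) * latticePoint τ (bottomRow q)) := by
    rw [latticeEquiv_apply]
    simp only [latticePoint, Prod.smul_fst, Prod.smul_snd]
    simp only [nsmul_eq_mul, Units.smul_def, smul_eq_mul]
    push_cast
    ring
  have hu : ((u : ℤ) : ℂ) ^ j = 1 := by
    rcases Int.units_eq_one_or u with rfl | rfl
    · simp
    · simpa using hj.neg_one_pow
  have hu' : ‖((u : ℤ) : ℂ)‖ = 1 := by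
    rcases Int.units_eq_one_or u with rfl | rfl <;> simp
  rw [epsteinTerm, latticeCoeff, if_neg hp, epsteinTerm, latticeCoeff,
    if_neg (bottomRow_ne_zero q), hlp, norm_mul, norm_mul, hu', one_mul, map_mul, map_mul, mul_pow,
    mul_pow, Complex.norm_natCast, Complex.ofReal_mul,
    Complex.mul_cpow_ofReal_nonneg (by positivity) (by positivity)]
  have e : (N : ℂ) ^ (2 * s - j) * ((((N : ℕ) : ℝ) : ℂ) ^ (-2 * s) * (N : ℂ) ^ j) = 1 := by
    rw [← Complex.cpow_natCast, Complex.ofReal_natCast, ← Complex.cpow_add _ _ hN,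
      ← Complex.cpow_add _ _ hN]
    ring_nf
    simp
  have e0 : (N : ℂ) ^ (2 * s - j) ≠ 0 := left_ne_zero_of_mul_eq_one e
  simp only [Complex.conj_natCast, map_intCast, hu, one_mul, neg_mul] at e ⊢
  field_simp
  linear_combination (conj (latticePoint τ (bottomRow q)) ^ j *
    (‖latticePoint τ (bottomRow q)‖ : ℂ) ^ (-(2 * s))) * e

theorem summable_epsteinTerm_bottomRow {j : ℕ} (τ : ℍ) {s : ℂ}
    (hs : 2 + j < 2 * s.re) : Summable fun q => epsteinTerm j τ s (bottomRow q) := by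
  refine (summable_epsteinTerm τ hs).comp_injective fun q q' h => ?_
  exact eq_of_bottomRow_eq_smul 1 (by rw [one_smul]; exact h)

/-- Summation over N gives ζ(2s − j), and the two units give the factor 2. -/
theorem tsum_epsteinTerm_eq {j : ℕ} (hj : Even j) (τ : ℍ) {s : ℂ} (hs : 2 + j < 2 * s.re) :
    ∑' p, epsteinTerm j τ s p =
      2 * riemannZeta (2 * s - j) * ∑' q, epsteinTerm j τ s (bottomRow q) := by
  have hw : 1 < (2 * s - j).re := by simp; linarith
  have h0 : Function.support (epsteinTerm j τ s) ⊆ {p : ℤ × ℤ | p ≠ 0} := by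
    intro p hp
    contrapose! hp
    simp only [Set.mem_ofPred_eq, not_not] at hp
    simp [epsteinTerm, latticeCoeff, hp]
  have hq := summable_epsteinTerm_bottomRow (j := j) τ hs
  have hsum : Summable fun x : Cosets × ℤˣ => epsteinTerm j τ s (bottomRow x.1) := by
    refine Summable.of_norm ((hq.norm.mul_of_nonneg (hasSum_fintype fun _ : ℤˣ => (1 : ℝ)).summable
      (fun _ => norm_nonneg _) (fun _ => zero_le_one)).congr fun x => mul_one _)
  have hζ : Summable fun N : ℕ+ => ‖1 / (N : ℂ) ^ (2 * s - j)‖ :=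
    ((Complex.summable_one_div_nat_cpow.2 hw).norm).comp_injective PNat.coe_injective
  rw [← tsum_subtype_eq_of_support_subset h0]
  change ∑' p : {p : ℤ × ℤ // p ≠ 0}, epsteinTerm j τ s p = _
  rw [← latticeEquiv.tsum_eq]
  simp only [epsteinTerm_latticeEquiv hj]
  rw [← tsum_mul_tsum_of_summable_norm hζ hsum.norm,
    tsum_pnat_eq_tsum_succ (f := fun n : ℕ => 1 / (n : ℂ) ^ (2 * s - j)), hsum.tsum_prod,
    zeta_eq_tsum_one_div_nat_add_one_cpow hw]
  simp only [tsum_fintype, Finset.sum_const, Finset.card_univ, Fintype.card_units_int,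
    nsmul_eq_mul, tsum_mul_left]
  push_cast
  ring

/-! ### The summands for j = 0 and j = 1 in terms of v. -/

section Summands

variable (τ : ℍ) (s : ℂ) (q : Cosets)

theorem latticePoint_bottomRow : latticePoint τ (bottomRow q) =
    (q.out 1 0 : ℂ) * τ + (q.out 1 1 : ℂ) := rfl

theorem im_out_smul_cpow : (((q.out • τ : ℍ).im : ℂ) ^ s) =
    (τ.im : ℂ) ^ s * epsteinTerm 0 τ s (bottomRow q) := by
  have hp := bottomRow_ne_zero q
  have hv := norm_latticePoint_pos τ hp
  rw [ModularGroup.im_smul_eq_div_normSq, ModularGroup.denom_apply, ← latticePoint_bottomRow,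
    epsteinTerm, latticeCoeff, if_neg hp, pow_zero, one_mul, Complex.normSq_eq_norm_sq,
    div_eq_mul_inv, Complex.ofReal_mul,
    Complex.mul_cpow_ofReal_nonneg τ.im_pos.le (by positivity), pow_two, mul_inv,
    Complex.ofReal_mul, Complex.mul_cpow_ofReal_nonneg (by positivity) (by positivity),
    Complex.ofReal_inv, Complex.inv_cpow _ _ (by
      rw [Complex.arg_ofReal_of_nonneg hv.le]; exact Real.pi_ne_zero.symm), ← Complex.cpow_neg,
    ← Complex.cpow_add _ _ (by exact_mod_cast hv.ne')]
  congr 2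
  ring

theorem epsteinTerm_two_add_one : epsteinTerm 2 τ (s + 1) (bottomRow q) =
    conj (latticePoint τ (bottomRow q)) / latticePoint τ (bottomRow q) *
      epsteinTerm 0 τ s (bottomRow q) := by
  have hp := bottomRow_ne_zero q
  have hv := norm_latticePoint_pos τ hp
  have hv0 : (‖latticePoint τ (bottomRow q)‖ : ℂ) ≠ 0 := by exact_mod_cast hv.ne'
  have hl := latticePoint_ne_zero τ hp
  have h := Complex.mul_conj' (latticePoint τ (bottomRow q))
  rw [epsteinTerm, latticeCoeff, if_neg hp, epsteinTerm, latticeCoeff, if_neg hp, pow_zero, one_mul,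
    mul_add, Complex.cpow_add _ _ hv0, mul_one, Complex.cpow_neg _ 2, Complex.cpow_ofNat, ← h]
  have hc : conj (latticePoint τ (bottomRow q)) ≠ 0 := by simpa using hl
  field_simp

theorem epsteinTerm_two_add_two : epsteinTerm 2 τ (s + 2) (bottomRow q) =
    (latticePoint τ (bottomRow q))⁻¹ ^ 2 * epsteinTerm 0 τ s (bottomRow q) := by
  have hp := bottomRow_ne_zero q
  have hv := norm_latticePoint_pos τ hp
  have hv0 : (‖latticePoint τ (bottomRow q)‖ : ℂ) ≠ 0 := by exact_mod_cast hv.ne'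
  have hl := latticePoint_ne_zero τ hp
  have h := Complex.mul_conj' (latticePoint τ (bottomRow q))
  have e : -2 * (s + 2) = -2 * s + -2 + -2 := by ring
  rw [epsteinTerm, latticeCoeff, if_neg hp, epsteinTerm, latticeCoeff, if_neg hp, pow_zero, one_mul,
    e, Complex.cpow_add _ _ hv0, Complex.cpow_add _ _ hv0, Complex.cpow_neg _ 2,
    Complex.cpow_ofNat, ← h]
  have hc : conj (latticePoint τ (bottomRow q)) ≠ 0 := by simpa using hl
  field_simp

theorem summand_eq (k : ℤ) {m j : ℕ} (hj : j ≤ m) (hkm : Even (k - m)) :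
    summand k m j hj hkm τ s q =
      C ((latticePoint τ (bottomRow q)) ^ (-k)) * (C (((q.out • τ : ℍ).im : ℂ) ^ s) *
        ((C (q.out 0 0 : ℂ) * X + C (q.out 0 1 : ℂ)) -
          C ((q.out • τ : ℍ) : ℂ) * (C (q.out 1 0 : ℂ) * X + C (q.out 1 1 : ℂ))) ^ j *
        (C (q.out 1 0 : ℂ) * X + C (q.out 1 1 : ℂ)) ^ (m - j)) := by
  conv_lhs => rw [← q.out_eq]
  rw [summand, Quotient.lift_mk, slash, polySlash_seed hj, latticePoint_bottomRow]

/-- det γ = 1 gives aX + b − γτ(cX + d) = (X − τ)/v; the automorphy factor supplies the second v⁻¹.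
-/
theorem summand_one_eq (h : Even ((1 : ℤ) - (1 : ℕ))) : summand 1 1 1 le_rfl h τ s q =
    C ((τ.im : ℂ) ^ s * epsteinTerm 2 τ (s + 2) (bottomRow q)) * (X - C (τ : ℂ)) := by
  have hl := latticePoint_ne_zero τ (bottomRow_ne_zero q)
  have hdet := q.out.det_coe
  rw [Matrix.det_fin_two] at hdet
  have hdet' : (q.out 0 0 : ℂ) * q.out 1 1 - q.out 0 1 * q.out 1 0 = 1 := by exact_mod_cast hdet
  have hsm : ((q.out • τ : ℍ) : ℂ) =
      ((q.out 0 0 : ℂ) * τ + q.out 0 1) / latticePoint τ (bottomRow q) := by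
    rw [UpperHalfPlane.coe_specialLinearGroup_apply, latticePoint_bottomRow]
    simp
  have h1 : (q.out 0 0 : ℂ) - ((q.out • τ : ℍ) : ℂ) * q.out 1 0 =
      (latticePoint τ (bottomRow q))⁻¹ := by
    rw [hsm]
    field_simp
    rw [latticePoint_bottomRow]
    linear_combination hdet'
  have h2 : (q.out 0 1 : ℂ) - ((q.out • τ : ℍ) : ℂ) * q.out 1 1 =
      -(τ * (latticePoint τ (bottomRow q))⁻¹) := by
    rw [hsm]
    field_simp
    rw [latticePoint_bottomRow]
    linear_combination (-(τ : ℂ)) * hdet'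
  have h1' := congrArg (C : ℂ → ℂ[X]) h1
  have h2' := congrArg (C : ℂ → ℂ[X]) h2
  rw [summand_eq, im_out_smul_cpow, epsteinTerm_two_add_two, zpow_neg_one]
  simp only [map_sub, map_mul, map_neg, map_pow] at h1' h2' ⊢
  rw [pow_one, Nat.sub_self, pow_zero, mul_one]
  linear_combination (C (latticePoint τ (bottomRow q))⁻¹ * (C ((τ.im : ℂ) ^ s) *
    C (epsteinTerm 0 τ s (bottomRow q)))) * (X * h1' + h2')

theorem summand_zero_eq (h : Even ((1 : ℤ) - (1 : ℕ))) : summand 1 1 0 zero_le_one h τ s q =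
    C ((latticePoint τ (bottomRow q))⁻¹ * ((τ.im : ℂ) ^ s * epsteinTerm 0 τ s (bottomRow q))) *
      (C (q.out 1 0 : ℂ) * X + C (q.out 1 1 : ℂ)) := by
  rw [summand_eq, im_out_smul_cpow, zpow_neg_one, pow_zero, mul_one, Nat.sub_zero, pow_one,
    ← mul_assoc, ← C_mul]

/-- The coefficient is c/v · Im(γτ)^s, and c = (v − v̄)/(2iy) splits it into a weight zero and a
weight two term. -/
theorem summand_zero_coeff_one (h : Even ((1 : ℤ) - (1 : ℕ))) :
    (summand 1 1 0 zero_le_one h τ s q).coeff 1 = (τ.im : ℂ) ^ s *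
      ((2 * Complex.I * τ.im)⁻¹ * (epsteinTerm 0 τ s (bottomRow q) -
        epsteinTerm 2 τ (s + 1) (bottomRow q))) := by
  have hl := latticePoint_ne_zero τ (bottomRow_ne_zero q)
  have hy : (τ.im : ℂ) ≠ 0 := by exact_mod_cast τ.im_pos.ne'
  have hc : latticePoint τ (bottomRow q) - conj (latticePoint τ (bottomRow q)) =
      2 * Complex.I * τ.im * q.out 1 0 := by
    rw [Complex.sub_conj, latticePoint_im]
    simp [bottomRow]
    ring
  rw [summand_zero_eq, coeff_C_mul, coeff_add, coeff_C_mul, coeff_X_one,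
    coeff_C_of_ne_zero one_ne_zero, mul_one, add_zero, epsteinTerm_two_add_one]
  have hI := Complex.I_ne_zero
  field_simp
  linear_combination (-((τ.im : ℂ) ^ s * epsteinTerm 0 τ s (bottomRow q))) * hc

/-- At X = τ the factor (cX + d)/v is 1, which ties the two coefficients together. -/
theorem summand_zero_coeff_zero (h : Even ((1 : ℤ) - (1 : ℕ))) :
    (summand 1 1 0 zero_le_one h τ s q).coeff 0 = (τ.im : ℂ) ^ s *
      epsteinTerm 0 τ s (bottomRow q) - τ * (summand 1 1 0 zero_le_one h τ s q).coeff 1 := by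
  have hl := latticePoint_ne_zero τ (bottomRow_ne_zero q)
  rw [summand_zero_eq, coeff_C_mul, coeff_add, coeff_C_mul, coeff_X_zero, coeff_C_zero, coeff_C_mul,
    coeff_add, coeff_C_mul, coeff_X_one, coeff_C_of_ne_zero one_ne_zero]
  rw [latticePoint_bottomRow] at hl ⊢
  field_simp
  ring

theorem summand_coeff_eq_zero {j : ℕ} (hj : j ≤ 1) (h : Even ((1 : ℤ) - (1 : ℕ))) {i : ℕ}
    (hi : 2 ≤ i) : (summand 1 1 j hj h τ s q).coeff i = 0 := by
  refine coeff_eq_zero_of_natDegree_lt (lt_of_le_of_lt ?_ hi)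
  interval_cases j
  · rw [summand_eq]
    compute_degree
  · rw [summand_one_eq]
    compute_degree

end Summands

/-! ### Residues, orders and the identity theorem. -/

section Meromorphic

/-- By Cauchy's integral formula the circle integrals are constant once the radius is small. -/
theorem residue_eq_of_eventuallyEq {f h : ℂ → ℂ} {z : ℂ} (hh : AnalyticAt ℂ h z)
    (hf : f =ᶠ[𝓝[≠] z] fun w => h w / (w - z)) : residue f z = h z := by
  refine Tendsto.limUnder_eq (tendsto_const_nhds.congr' ?_)
  obtain ⟨ε, hε, hball⟩ := Metric.eventually_nhds_iff_ball.1
    (hh.eventually_analyticAt.and (eventually_nhdsWithin_iff.1 hf))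
  filter_upwards [Ioo_mem_nhdsGT hε] with r hr
  have hsub : Metric.closedBall z r ⊆ Metric.ball z ε := Metric.closedBall_subset_ball hr.2
  have h1 : (∮ w in C(z, r), f w) = ∮ w in C(z, r), (w - z)⁻¹ • h w := by
    refine circleIntegral.integral_congr hr.1.le fun w hw => ?_
    have hne : w ≠ z := by
      rintro rfl
      simp [hr.1.ne] at hw
    rw [(hball w (hsub (Metric.sphere_subset_closedBall hw))).2 hne, smul_eq_mul]
    exact div_eq_inv_mul _ _
  have hd : DifferentiableOn ℂ h (Metric.closedBall z r) := fun w hw =>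
    (hball w (hsub hw)).1.differentiableAt.differentiableWithinAt
  rw [h1, (hd.diffContOnCl_ball subset_rfl).circleIntegral_sub_inv_smul (Metric.mem_ball_self hr.1),
    smul_eq_mul, inv_mul_cancel_left₀ Complex.two_pi_I_ne_zero]

theorem neg_one_le_meromorphicOrderAt {f h : ℂ → ℂ} {z : ℂ} (hh : AnalyticAt ℂ h z)
    (hf : f =ᶠ[𝓝[≠] z] fun w => h w / (w - z)) : -1 ≤ meromorphicOrderAt f z := by
  rw [meromorphicOrderAt_congr hf, show (fun w => h w / (w - z)) = h * (fun w => w - z)⁻¹ by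
    ext w; simp [div_eq_mul_inv], meromorphicOrderAt_mul hh.meromorphicAt (by fun_prop),
    meromorphicOrderAt_inv, meromorphicOrderAt_id_sub_const]
  have h0 := hh.meromorphicOrderAt_nonneg
  generalize meromorphicOrderAt h z = n at h0
  induction n with
  | top => simp
  | coe n =>
    have h0' : 0 ≤ n := by exact_mod_cast h0
    have : (-1 : ℤ) ≤ n + -1 := by omega
    exact WithTop.coe_le_coe.2 this

/-- Identity theorem: on a connected set, infinite order of f − g at one point forces infinite order
at every point. -/
theorem eventuallyEq_nhdsNE_of_eventuallyEq {f g : ℂ → ℂ} (hf : MeromorphicOn f Set.univ)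
    (hg : MeromorphicOn g Set.univ) {z₀ : ℂ} (h : f =ᶠ[𝓝[≠] z₀] g) (z : ℂ) : f =ᶠ[𝓝[≠] z] g := by
  have hfg := hf.sub hg
  have h0 : meromorphicOrderAt (f - g) z₀ = ⊤ := by
    rw [meromorphicOrderAt_eq_top_iff]
    filter_upwards [h] with w hw
    simp [hw]
  have h1 : meromorphicOrderAt (f - g) z = ⊤ := by
    by_contra hne
    exact hfg.meromorphicOrderAt_ne_top_of_isPreconnected isPreconnected_univ (Set.mem_univ z)
      (Set.mem_univ z₀) hne h0
  filter_upwards [meromorphicOrderAt_eq_top_iff.1 h1] with w hw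
  exact sub_eq_zero.1 hw

/-- At s = 1, ζ is the quotient by s − 1 of (s − 1)ζ(s), which becomes analytic once given the value
1 there. -/
theorem meromorphicAt_riemannZeta (s : ℂ) : MeromorphicAt riemannZeta s := by
  have han : ∀ s : ℂ, s ≠ 1 → AnalyticAt ℂ riemannZeta s := fun s hs =>
    (DifferentiableOn.analyticAt (s := {(1 : ℂ)}ᶜ) (fun w hw =>
      (differentiableAt_riemannZeta hw).differentiableWithinAt)
      (isOpen_compl_singleton.mem_nhds hs))
  by_cases hs : s = 1
  · subst hs
    have hg : AnalyticAt ℂ (Function.update (fun s => (s - 1) * riemannZeta s) 1 1) 1 := by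
      refine Complex.analyticAt_of_differentiable_on_punctured_nhds_of_continuousAt ?_ ?_
      · filter_upwards [self_mem_nhdsWithin] with w hw
        refine ((differentiableAt_id.sub_const 1).mul
          (differentiableAt_riemannZeta hw)).congr_of_eventuallyEq ?_
        filter_upwards [isOpen_compl_singleton.mem_nhds hw] with v hv
        simp [Function.update_of_ne hv]
      · exact continuousAt_update_same.2 riemannZeta_residue_one
    refine (hg.meromorphicAt.div (g := fun s => s - 1) (by fun_prop)).congr ?_
    filter_upwards [self_mem_nhdsWithin] with w hw
    have : w - 1 ≠ 0 := sub_ne_zero.2 hw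
    simp only [Pi.div_apply, Function.update_of_ne hw]
    field_simp
  · exact (han s hs).meromorphicAt

end Meromorphic

/-! ### Continuation of the weight zero and weight two series. -/

/-- The meromorphic continuation of `∑ Im (γ τ) ^ s` over `Γ_∞ \ SL(2, ℤ)`. -/
noncomputable def weightZero (τ : ℍ) (s : ℂ) : ℂ :=
  (Real.pi : ℂ) ^ s * (thetaPair τ).Λ s * (Complex.Gamma s)⁻¹ * (2 * riemannZeta (2 * s))⁻¹

/-- The meromorphic continuation of `∑ (c τ + d) ^ (-2) Im (γ τ) ^ s` over `Γ_∞ \ SL(2, ℤ)`. -/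
noncomputable def weightTwo (τ : ℍ) (s : ℂ) : ℂ :=
  ((τ.im : ℂ) ^ 2)⁻¹ * (Real.pi : ℂ) ^ (s + 2) * (thetaPair₂ τ).Λ (s + 2) *
    (Complex.Gamma (s + 2))⁻¹ * (2 * riemannZeta (2 * s + 2))⁻¹

theorem weightZero_eq (τ : ℍ) {s : ℂ} (hs : 1 < s.re) :
    weightZero τ s = (τ.im : ℂ) ^ s * ∑' q, epsteinTerm 0 τ s (bottomRow q) := by
  have hG : Complex.Gamma s ≠ 0 := Complex.Gamma_ne_zero_of_re_pos (by linarith)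
  have hz : riemannZeta (2 * s) ≠ 0 := riemannZeta_ne_zero_of_one_lt_re (by simp; linarith)
  have hπ : (Real.pi : ℂ) ^ s ≠ 0 := by
    simp [Complex.cpow_eq_zero_iff, Real.pi_ne_zero]
  rw [weightZero, Λ_thetaPair τ hs, tsum_epsteinTerm_eq Even.zero τ (by push_cast; linarith),
    Complex.div_cpow_ofReal_nonneg τ.im_pos.le Real.pi_pos.le]
  simp only [Nat.cast_zero, sub_zero]
  generalize (Real.pi : ℂ) ^ s = P at hπ
  field_simp

theorem weightTwo_eq_tsum (τ : ℍ) {s : ℂ} (hs : 0 < s.re) :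
    weightTwo τ s = (τ.im : ℂ) ^ s * (∑' p, epsteinTerm 2 τ (s + 2) p) *
      (2 * riemannZeta (2 * s + 2))⁻¹ := by
  have hy : (τ.im : ℂ) ≠ 0 := by exact_mod_cast τ.im_pos.ne'
  have hG : Complex.Gamma (s + 2) ≠ 0 := Complex.Gamma_ne_zero_of_re_pos (by simp; linarith)
  have hπ : (Real.pi : ℂ) ^ (s + 2) ≠ 0 := by
    simp [Complex.cpow_eq_zero_iff, Real.pi_ne_zero]
  have h2 : (τ.im : ℂ) ^ (s + 2) = (τ.im : ℂ) ^ s * (τ.im : ℂ) ^ 2 := by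
    rw [Complex.cpow_add _ _ hy, Complex.cpow_ofNat]
  rw [weightTwo, Λ_thetaPair₂ τ (by simp; linarith),
    Complex.div_cpow_ofReal_nonneg τ.im_pos.le Real.pi_pos.le, h2]
  generalize (Real.pi : ℂ) ^ (s + 2) = P at hπ
  generalize (2 * riemannZeta (2 * s + 2))⁻¹ = Z
  field_simp

theorem weightTwo_eq (τ : ℍ) {s : ℂ} (hs : 0 < s.re) :
    weightTwo τ s = (τ.im : ℂ) ^ s * ∑' q, epsteinTerm 2 τ (s + 2) (bottomRow q) := by
  have hz : riemannZeta (2 * s + 2) ≠ 0 :=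
    riemannZeta_ne_zero_of_one_lt_re (by simp; linarith)
  rw [weightTwo_eq_tsum τ hs, tsum_epsteinTerm_eq even_two τ (by simp; linarith)]
  rw [show 2 * (s + 2) - ((2 : ℕ) : ℂ) = 2 * s + 2 by push_cast; ring]
  generalize riemannZeta (2 * s + 2) = Z at hz
  field_simp

theorem meromorphicAt_weightZero (τ : ℍ) (s : ℂ) : MeromorphicAt (weightZero τ) s := by
  have hΛ₀ : AnalyticAt ℂ (thetaPair τ).Λ₀ s := (thetaPair τ).differentiable_Λ₀.analyticAt s
  have hΛ : MeromorphicAt (thetaPair τ).Λ s :=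
    (hΛ₀.meromorphicAt.sub (g := fun s => (1 / s) • (thetaPair τ).f₀) (by fun_prop)).sub
      (g := fun s => ((thetaPair τ).ε / ((thetaPair τ).k - s)) • (thetaPair τ).g₀) (by fun_prop)
  have hG : AnalyticAt ℂ (fun s => (Complex.Gamma s)⁻¹) s :=
    Complex.differentiable_one_div_Gamma.analyticAt s
  have hπ : AnalyticAt ℂ (fun s : ℂ => (Real.pi : ℂ) ^ s) s :=
    (differentiable_id.const_cpow (Or.inl (Complex.ofReal_ne_zero.2 Real.pi_ne_zero))).analyticAt s
  have hz : MeromorphicAt (fun s => riemannZeta (2 * s)) s :=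
    (meromorphicAt_riemannZeta (2 * s)).comp_analyticAt (g := fun s => 2 * s) (by fun_prop)
  exact ((hπ.meromorphicAt.mul hΛ).mul hG.meromorphicAt).mul
    ((MeromorphicAt.const (2 : ℂ) s).mul hz).inv

theorem differentiable_pi_cpow : Differentiable ℂ fun s : ℂ => (Real.pi : ℂ) ^ s :=
  differentiable_id.const_cpow (Or.inl (Complex.ofReal_ne_zero.2 Real.pi_ne_zero))

theorem differentiableAt_inv_two_mul_riemannZeta {g : ℂ → ℂ} {s : ℂ} (hg : DifferentiableAt ℂ g s)
    (hs : 1 < (g s).re) : DifferentiableAt ℂ (fun s => (2 * riemannZeta (g s))⁻¹) s := by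
  have hne : g s ≠ 1 := fun h => by simp [h] at hs
  have hz : riemannZeta (g s) ≠ 0 := riemannZeta_ne_zero_of_one_lt_re hs
  exact (((differentiableAt_riemannZeta hne).comp s hg).const_mul 2).inv
    (mul_ne_zero two_ne_zero hz)

theorem analyticAt_of_differentiableAt_of_lt_re {f : ℂ → ℂ} {a : ℝ}
    (hf : ∀ s : ℂ, a < s.re → DifferentiableAt ℂ f s) {s : ℂ} (hs : a < s.re) :
    AnalyticAt ℂ f s :=
  DifferentiableOn.analyticAt (s := {s : ℂ | a < s.re})
    (fun w hw => (hf w hw).differentiableWithinAt)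
    ((isOpen_lt continuous_const Complex.continuous_re).mem_nhds hs)

theorem analyticAt_weightZero (τ : ℍ) {s : ℂ} (hs : 1 < s.re) :
    AnalyticAt ℂ (weightZero τ) s := by
  refine analyticAt_of_differentiableAt_of_lt_re (fun w hw => ?_) hs
  have h0 : w ≠ 0 := fun h => by simp [h] at hw; linarith
  have h1 : w ≠ ((thetaPair τ).k : ℂ) := fun h => by simp [h, thetaPair] at hw
  exact ((differentiable_pi_cpow.differentiableAt.mul
    ((thetaPair τ).differentiableAt_Λ (Or.inl h0) (Or.inl h1))).mul
    Complex.differentiable_one_div_Gamma.differentiableAt).mul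
    (differentiableAt_inv_two_mul_riemannZeta (by fun_prop) (by simp; linarith))

/-- The function `(s - 1) * weightZero τ s`, with the singularity at `1` removed. -/
theorem exists_weightZero_eq_div (τ : ℍ) : ∃ h : ℂ → ℂ, AnalyticAt ℂ h 1 ∧ h 1 = 3 / Real.pi ∧
    weightZero τ =ᶠ[𝓝[≠] 1] fun s => h s / (s - 1) := by
  -- Multiply Λ(s) = Λ₀(s) − 1/s + 1/(s − 1) by s − 1. At s = 1 this leaves π/(2ζ(2)) = 3/π.
  refine ⟨fun s => (Real.pi : ℂ) ^ s * ((s - 1) * (thetaPair τ).Λ₀ s - (s - 1) * s⁻¹ + 1) *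
    (Complex.Gamma s)⁻¹ * (2 * riemannZeta (2 * s))⁻¹, ?_, ?_, ?_⟩
  · refine analyticAt_of_differentiableAt_of_lt_re (a := 1 / 2) (fun w hw => ?_) (by norm_num)
    have h0 : w ≠ 0 := fun h => by simp [h] at hw; linarith
    have hd : DifferentiableAt ℂ
        (fun s => (s - 1) * (thetaPair τ).Λ₀ s - (s - 1) * s⁻¹ + 1) w :=
      ((((differentiableAt_id.sub_const 1).mul ((thetaPair τ).differentiable_Λ₀ w)).sub
        ((differentiableAt_id.sub_const 1).mul (differentiableAt_inv h0)))).add_const 1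
    exact ((differentiable_pi_cpow.differentiableAt.mul hd).mul
      Complex.differentiable_one_div_Gamma.differentiableAt).mul
      (differentiableAt_inv_two_mul_riemannZeta (by fun_prop) (by simp; linarith))
  · have hπ : (Real.pi : ℂ) ≠ 0 := Complex.ofReal_ne_zero.2 Real.pi_ne_zero
    simp only [sub_self, zero_mul, zero_add, mul_one, Complex.cpow_one, Complex.Gamma_one,
      inv_one, riemannZeta_two]
    field_simp
    norm_num
  · have h0 : ∀ᶠ s : ℂ in 𝓝[≠] 1, s ≠ 0 :=
      (eventually_ne_nhds one_ne_zero).filter_mono nhdsWithin_le_nhds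
    filter_upwards [h0, self_mem_nhdsWithin] with s hs hs1
    have hs1' : s - 1 ≠ 0 := sub_ne_zero.2 hs1
    have hs1'' : 1 - s ≠ 0 := sub_ne_zero.2 (Ne.symm hs1)
    have hΛ : (thetaPair τ).Λ s =
        ((s - 1) * (thetaPair τ).Λ₀ s - (s - 1) * s⁻¹ + 1) / (s - 1) := by
      simp only [WeakFEPair.Λ, thetaPair, smul_eq_mul, Complex.ofReal_one]
      field_simp
      ring
    rw [weightZero, hΛ]
    ring

theorem meromorphicAt_weightTwo (τ : ℍ) (s : ℂ) : MeromorphicAt (weightTwo τ) s := by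
  have hΛ : AnalyticAt ℂ (fun s => (thetaPair₂ τ).Λ (s + 2)) s :=
    Differentiable.analyticAt ((isStrongFEPair_thetaPair₂ τ).differentiable_Λ.comp
      (differentiable_id.add_const 2)) s
  have hG : AnalyticAt ℂ (fun s => (Complex.Gamma (s + 2))⁻¹) s :=
    Differentiable.analyticAt (Complex.differentiable_one_div_Gamma.comp
      (differentiable_id.add_const 2)) s
  have hπ : AnalyticAt ℂ (fun s : ℂ => (Real.pi : ℂ) ^ (s + 2)) s :=
    Differentiable.analyticAt (differentiable_pi_cpow.comp (differentiable_id.add_const 2)) s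
  have hz : MeromorphicAt (fun s => riemannZeta (2 * s + 2)) s :=
    (meromorphicAt_riemannZeta (2 * s + 2)).comp_analyticAt (g := fun s => 2 * s + 2)
      (by fun_prop)
  exact ((((MeromorphicAt.const (((τ.im : ℂ) ^ 2)⁻¹) s).mul hπ.meromorphicAt).mul
    hΛ.meromorphicAt).mul hG.meromorphicAt).mul ((MeromorphicAt.const (2 : ℂ) s).mul hz).inv

/-- Λ and 1/Γ are entire, and ζ(2s + 2) has neither zero nor pole where Re(2s + 2) > 1. This half
plane contains s = 0. -/
theorem analyticAt_weightTwo (τ : ℍ) {s : ℂ} (hs : -1 / 2 < s.re) :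
    AnalyticAt ℂ (weightTwo τ) s := by
  refine analyticAt_of_differentiableAt_of_lt_re (fun w hw => ?_) hs
  have ha : Differentiable ℂ fun s : ℂ => s + 2 := differentiable_id.add_const 2
  exact ((((differentiable_pi_cpow.comp ha).differentiableAt.const_mul _).mul
    ((isStrongFEPair_thetaPair₂ τ).differentiable_Λ.comp ha).differentiableAt).mul
    (Complex.differentiable_one_div_Gamma.comp ha).differentiableAt).mul
    (differentiableAt_inv_two_mul_riemannZeta (by fun_prop) (by simp; linarith))

/-- The value at 0 is the limit along positive reals, where Hecke's formula gives (G₂ −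
π/y)/(2ζ(2)), and 2ζ(2) = π²/3. -/
theorem weightTwo_zero (τ : ℍ) : weightTwo τ 0 = E2hol τ - 3 / (Real.pi * τ.im) := by
  have hπ : (Real.pi : ℂ) ≠ 0 := Complex.ofReal_ne_zero.2 Real.pi_ne_zero
  have hy : (τ.im : ℂ) ≠ 0 := by exact_mod_cast τ.im_pos.ne'
  have hcast : Tendsto (fun s : ℝ => (s : ℂ)) (𝓝[>] 0) (𝓝 0) :=
    (Complex.continuous_ofReal.tendsto' 0 0 Complex.ofReal_zero).mono_left nhdsWithin_le_nhds
  have h1 : Tendsto (fun s : ℝ => weightTwo τ s) (𝓝[>] 0) (𝓝 (weightTwo τ 0)) :=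
    (analyticAt_weightTwo τ (s := 0) (by norm_num)).continuousAt.tendsto.comp hcast
  have h2 : Tendsto (fun s : ℝ => (τ.im : ℂ) ^ (s : ℂ) * (∑' p, epsteinTerm 2 τ (s + 2) p) *
      (2 * riemannZeta (2 * s + 2))⁻¹) (𝓝[>] 0)
      (𝓝 (1 * (EisensteinSeries.G2 τ - Real.pi / τ.im) * (2 * riemannZeta 2)⁻¹)) := by
    refine (Tendsto.mul ?_ (tendsto_tsum_epsteinTerm_two τ)).mul ?_
    · have : ContinuousAt (fun s : ℂ => (τ.im : ℂ) ^ s) 0 :=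
        continuousAt_const_cpow hy
      simpa [Function.comp_def] using this.tendsto.comp hcast
    · have : ContinuousAt (fun s : ℂ => (2 * riemannZeta (2 * s + 2))⁻¹) 0 :=
        (differentiableAt_inv_two_mul_riemannZeta (g := fun s => 2 * s + 2) (by fun_prop)
          (by norm_num)).continuousAt
      simpa [Function.comp_def] using this.tendsto.comp hcast
  have h3 := tendsto_nhds_unique (h1.congr' (by
    filter_upwards [self_mem_nhdsWithin] with s hs
    exact weightTwo_eq_tsum τ (by simpa using hs))) h2
  have h4 : E2hol τ = EisensteinSeries.E2 τ := by
    rw [EisensteinSeries.E2_eq_tsum_cexp, E2hol]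
    congr 3
    ext n
    congr 1
    rw [← Complex.exp_nat_mul]
    congr 1
    ring
  rw [h3, h4, EisensteinSeries.E2, riemannZeta_two]
  simp only [Pi.smul_apply, smul_eq_mul]
  field_simp
  ring

/-! ### Existence and uniqueness of continuations. -/

section Continuation

/-- Two continuations agree, coefficient by coefficient, away from a discrete set. -/
theorem IsContinuation.coeff_eventuallyEq {j : ℕ} {hj : j ≤ 1} {h : Even ((1 : ℤ) - (1 : ℕ))}
    {τ : ℍ} {F : ℂ → ℂ[X]} (hF : IsContinuation 1 1 j hj h τ F) {i : ℕ} (hi : i ≤ 1) {c : ℂ → ℂ}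
    (hc : MeromorphicOn c Set.univ)
    (heq : ∀ s : ℂ, 1 < s.re → c s = ∑' q, (summand 1 1 j hj h τ s q).coeff i) (z : ℂ) :
    (fun s => (F s).coeff i) =ᶠ[𝓝[≠] z] c := by
  refine eventuallyEq_nhdsNE_of_eventuallyEq (hF.meromorphic i).meromorphicOn hc
    (z₀ := 2) (Filter.EventuallyEq.filter_mono ?_ nhdsWithin_le_nhds) z
  filter_upwards [(isOpen_lt continuous_const Complex.continuous_re).mem_nhds
    (show (1 : ℝ) < (2 : ℂ).re by norm_num)] with s hs
  have hs' : 1 < s.re := hs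
  rw [hF.eq_series s (by push_cast; linarith), heq s hs', eisensteinSeries]
  simp only [finsetSum_coeff, coeff_monomial, Finset.sum_ite_eq']
  rw [if_pos (Finset.mem_range.2 (by omega))]

theorem IsContinuation.coeff_eq_zero {j : ℕ} {hj : j ≤ 1} {h : Even ((1 : ℤ) - (1 : ℕ))}
    {τ : ℍ} {F : ℂ → ℂ[X]} (hF : IsContinuation 1 1 j hj h τ F) {i : ℕ} (hi : 2 ≤ i) (s : ℂ) :
    (F s).coeff i = 0 :=
  coeff_eq_zero_of_degree_lt
    ((Polynomial.mem_degreeLE.1 (hF.mem_degreeLE s)).trans_lt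
      (by exact_mod_cast (by omega : 1 < i)))

/-- Functions in normal form that agree on a punctured neighbourhood also agree at its centre. This
determines the value of the continuation at a removable point such as s = 0. -/
theorem IsContinuation.coeff_eventuallyEq_nhds {j : ℕ} {hj : j ≤ 1}
    {h : Even ((1 : ℤ) - (1 : ℕ))} {τ : ℍ} {F : ℂ → ℂ[X]} (hF : IsContinuation 1 1 j hj h τ F)
    {i : ℕ} (hi : i ≤ 1) {c : ℂ → ℂ} (hc : MeromorphicOn c Set.univ)
    (heq : ∀ s : ℂ, 1 < s.re → c s = ∑' q, (summand 1 1 j hj h τ s q).coeff i) {z : ℂ}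
    (hz : AnalyticAt ℂ c z) : (fun s => (F s).coeff i) =ᶠ[𝓝 z] c :=
  ((hF.meromorphic i (Set.mem_univ z)).eventuallyEq_nhdsNE_iff_eventuallyEq_nhds
    hz.meromorphicNFAt).1 (hF.coeff_eventuallyEq hi hc heq z)

/-- Passing to normal form changes nothing where `c i` is already analytic, so the series values for
Re s > 1 survive. Only indices 0 and 1 enter the polynomial. -/
theorem exists_isContinuation {j : ℕ} (hj : j ≤ 1) (h : Even ((1 : ℤ) - (1 : ℕ))) (τ : ℍ)
    (c : ℕ → ℂ → ℂ) (hc : ∀ i, MeromorphicOn (c i) Set.univ)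
    (han : ∀ i, ∀ s : ℂ, 1 < s.re → AnalyticAt ℂ (c i) s)
    (heq : ∀ i ≤ 1, ∀ s : ℂ, 1 < s.re → c i s = ∑' q, (summand 1 1 j hj h τ s q).coeff i) :
    ∃ F : ℂ → ℂ[X], IsContinuation 1 1 j hj h τ F := by
  have hcoeff : ∀ (s : ℂ) (i : ℕ), (∑ i ∈ Finset.range 2,
      monomial i (toMeromorphicNFOn (c i) Set.univ s)).coeff i =
      if i < 2 then toMeromorphicNFOn (c i) Set.univ s else 0 := by
    intro s i
    simp only [finsetSum_coeff, coeff_monomial, Finset.sum_ite_eq', Finset.mem_range]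
  refine ⟨fun s => ∑ i ∈ Finset.range 2, monomial i (toMeromorphicNFOn (c i) Set.univ s),
    fun s => ?_, fun i => ?_, fun s hs => ?_⟩
  · refine Submodule.sum_mem _ fun i hi => mem_degreeLE.2 ((degree_monomial_le _ _).trans ?_)
    exact_mod_cast Nat.lt_succ_iff.1 (Finset.mem_range.1 hi)
  · simp only [hcoeff]
    by_cases hi : i < 2
    · simpa only [if_pos hi] using meromorphicNFOn_toMeromorphicNFOn (c i) Set.univ
    · simp only [if_neg hi]
      exact fun z _ => analyticAt_const.meromorphicNFAt
  · have hs' : 1 < s.re := by push_cast at hs; linarith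
    refine Finset.sum_congr rfl fun i hi => ?_
    rw [toMeromorphicNFOn_eq_toMeromorphicNFAt (hc i) (Set.mem_univ s),
      toMeromorphicNFAt_eq_self.2 (han i s hs').meromorphicNFAt,
      heq i (Nat.lt_succ_iff.1 (Finset.mem_range.1 hi)) s hs']

end Continuation

/-! ### The coefficients of the two Eisenstein series. -/

section Coefficients

variable (τ : ℍ)

/-- The continuation of the coefficients of `E_{1, 1}(τ, 0, s)`. -/
noncomputable def coeffZero : ℕ → ℂ → ℂ
  | 0 => fun s => weightZero τ s - τ * ((2 * Complex.I * τ.im)⁻¹ *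
      (weightZero τ s - τ.im * weightTwo τ (s - 1)))
  | _ + 1 => fun s => (2 * Complex.I * τ.im)⁻¹ *
      (weightZero τ s - τ.im * weightTwo τ (s - 1))

/-- The continuation of the coefficients of `E_{1, 1}(τ, 1, s)`. -/
noncomputable def coeffOne : ℕ → ℂ → ℂ
  | 0 => fun s => -τ * weightTwo τ s
  | _ + 1 => weightTwo τ

theorem meromorphicAt_weightTwo_sub_one (s : ℂ) :
    MeromorphicAt (fun s => weightTwo τ (s - 1)) s :=
  (meromorphicAt_weightTwo τ (s - 1)).comp_analyticAt (g := fun s => s - 1) (by fun_prop)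

theorem analyticAt_weightTwo_sub_one {s : ℂ} (hs : 1 / 2 < s.re) :
    AnalyticAt ℂ (fun s => weightTwo τ (s - 1)) s :=
  (analyticAt_weightTwo τ (s := s - 1) (by simp; linarith)).fun_comp
    (f := fun s => s - 1) (by fun_prop)

theorem meromorphicOn_coeffZero (i : ℕ) : MeromorphicOn (coeffZero τ i) Set.univ := by
  intro s _
  have h1 : MeromorphicAt (coeffZero τ 1) s :=
    (MeromorphicAt.const _ s).mul ((meromorphicAt_weightZero τ s).sub
      ((MeromorphicAt.const _ s).mul (meromorphicAt_weightTwo_sub_one τ s)))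
  cases i with
  | zero => exact (meromorphicAt_weightZero τ s).sub ((MeromorphicAt.const _ s).mul h1)
  | succ i => exact h1

theorem analyticAt_coeffZero (i : ℕ) {s : ℂ} (hs : 1 < s.re) :
    AnalyticAt ℂ (coeffZero τ i) s := by
  have h1 : AnalyticAt ℂ (coeffZero τ 1) s :=
    analyticAt_const.mul ((analyticAt_weightZero τ hs).sub
      (analyticAt_const.mul (analyticAt_weightTwo_sub_one τ (by linarith))))
  cases i with
  | zero => exact (analyticAt_weightZero τ hs).sub (analyticAt_const.mul h1)
  | succ i => exact h1

theorem meromorphicOn_coeffOne (i : ℕ) : MeromorphicOn (coeffOne τ i) Set.univ := by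
  intro s _
  cases i with
  | zero => exact (MeromorphicAt.const _ s).mul (meromorphicAt_weightTwo τ s)
  | succ i => exact meromorphicAt_weightTwo τ s

theorem analyticAt_coeffOne (i : ℕ) {s : ℂ} (hs : -1 / 2 < s.re) :
    AnalyticAt ℂ (coeffOne τ i) s := by
  cases i with
  | zero => exact analyticAt_const.mul (analyticAt_weightTwo τ hs)
  | succ i => exact analyticAt_weightTwo τ hs

theorem hasSum_weightZero {s : ℂ} (hs : 1 < s.re) :
    HasSum (fun q => (τ.im : ℂ) ^ s * epsteinTerm 0 τ s (bottomRow q)) (weightZero τ s) := by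
  rw [weightZero_eq τ hs]
  exact ((summable_epsteinTerm_bottomRow τ (by push_cast; linarith)).hasSum).mul_left _

theorem hasSum_weightTwo {s : ℂ} (hs : 0 < s.re) :
    HasSum (fun q => (τ.im : ℂ) ^ s * epsteinTerm 2 τ (s + 2) (bottomRow q)) (weightTwo τ s) := by
  rw [weightTwo_eq τ hs]
  exact ((summable_epsteinTerm_bottomRow τ (by simp; linarith)).hasSum).mul_left _

theorem hasSum_summand_zero {s : ℂ} (hs : 1 < s.re) (h : Even ((1 : ℤ) - (1 : ℕ))) {i : ℕ}
    (hi : i ≤ 1) :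
    HasSum (fun q => (summand 1 1 0 zero_le_one h τ s q).coeff i) (coeffZero τ i s) := by
  have hy : (τ.im : ℂ) ≠ 0 := by exact_mod_cast τ.im_pos.ne'
  have h1 : HasSum (fun q => (summand 1 1 0 zero_le_one h τ s q).coeff 1) (coeffZero τ 1 s) := by
    have h2 := ((hasSum_weightZero τ hs).sub
      ((hasSum_weightTwo τ (s := s - 1) (by simpa using hs)).mul_left (τ.im : ℂ))).mul_left
      (2 * Complex.I * τ.im)⁻¹
    refine Eq.subst (motive := fun f => HasSum f (coeffZero τ 1 s)) (funext fun q => ?_) h2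
    have hpow : (τ.im : ℂ) ^ s = τ.im * (τ.im : ℂ) ^ (s - 1) := by
      rw [Complex.cpow_sub _ _ hy, Complex.cpow_one, mul_div_cancel₀ _ hy]
    rw [summand_zero_coeff_one, show s - 1 + 2 = s + 1 by ring, hpow]
    ring
  interval_cases i
  · simp only [summand_zero_coeff_zero]
    exact (hasSum_weightZero τ hs).sub (h1.mul_left (τ : ℂ))
  · exact h1

theorem hasSum_summand_one {s : ℂ} (hs : 0 < s.re) (h : Even ((1 : ℤ) - (1 : ℕ))) {i : ℕ}
    (hi : i ≤ 1) :
    HasSum (fun q => (summand 1 1 1 le_rfl h τ s q).coeff i) (coeffOne τ i s) := by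
  have h2 := hasSum_weightTwo τ hs
  interval_cases i
  · refine Eq.subst (motive := fun f => HasSum f (coeffOne τ 0 s)) (funext fun q => ?_)
      (h2.mul_left (-τ : ℂ))
    rw [summand_one_eq, coeff_C_mul, coeff_sub, coeff_X_zero, coeff_C_zero]
    ring
  · refine Eq.subst (motive := fun f => HasSum f (coeffOne τ 1 s)) (funext fun q => ?_) h2
    rw [summand_one_eq, coeff_C_mul, coeff_sub, coeff_X_one, coeff_C_of_ne_zero one_ne_zero]
    ring

/-- Only the weight zero part has a pole at 1: the shifted term W₂(s − 1) is analytic there and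
drops out of the residue. -/
theorem exists_coeffZero_eq_div : ∃ h : ℕ → ℂ → ℂ, (∀ i, AnalyticAt ℂ (h i) 1) ∧
    h 0 1 = 3 / Real.pi - τ * (3 / Real.pi / (2 * Complex.I * τ.im)) ∧
    h 1 1 = 3 / Real.pi / (2 * Complex.I * τ.im) ∧
    ∀ i, coeffZero τ i =ᶠ[𝓝[≠] 1] fun s => h i s / (s - 1) := by
  obtain ⟨g, hg, hg1, hgeq⟩ := exists_weightZero_eq_div τ
  set g₁ : ℂ → ℂ := fun s => (2 * Complex.I * τ.im)⁻¹ *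
    (g s - (s - 1) * (τ.im * weightTwo τ (s - 1))) with hg₁
  have hg₁an : AnalyticAt ℂ g₁ 1 := analyticAt_const.mul (hg.sub
    ((analyticAt_id.sub analyticAt_const).mul
      (analyticAt_const.mul (analyticAt_weightTwo_sub_one τ (by norm_num)))))
  have hg₁eq : coeffZero τ 1 =ᶠ[𝓝[≠] 1] fun s => g₁ s / (s - 1) := by
    filter_upwards [hgeq, self_mem_nhdsWithin] with s hs hs1
    have hs1' : s - 1 ≠ 0 := sub_ne_zero.2 hs1
    simp only [coeffZero, hs, hg₁]
    field_simp
  refine ⟨fun i => if i = 0 then fun s => g s - τ * g₁ s else g₁, fun i => ?_, ?_, ?_, fun i => ?_⟩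
  · dsimp only
    split_ifs
    · exact hg.sub (analyticAt_const.mul hg₁an)
    · exact hg₁an
  · simp [hg₁, hg1, div_eq_inv_mul]
  · simp [hg₁, hg1, div_eq_inv_mul]
  · cases i with
    | zero =>
      filter_upwards [hgeq, hg₁eq] with s hs hs₁
      have : coeffZero τ 0 s = weightZero τ s - τ * coeffZero τ 1 s := rfl
      rw [this, hs, hs₁]
      simp only [if_true]
      ring
    | succ i => exact hg₁eq

end Coefficients

end VectorEisenstein

/-! ### The limit formula. -/

open VectorEisenstein in
theorem mainTheorem6 (τ : ℍ) :
    -- The series for `E_{1,1}(τ, j, s)` converge absolutely for `Re s > 1`.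
    (∀ (j : ℕ) (hj : j ≤ 1) (s : ℂ), 1 < s.re → ∀ i : ℕ,
      Summable fun q => ((VectorEisenstein.summand 1 1 j hj (by decide) τ s q).coeff i)) ∧
    -- They have meromorphic continuations in `s` to the complex plane.
    (∀ (j : ℕ) (hj : j ≤ 1),
      ∃ F : ℂ → ℂ[X], VectorEisenstein.IsContinuation 1 1 j hj (by decide) τ F) ∧
    -- `F₀ s` is `E_{1,1}(τ, 0, s)` and `F₁ s` is `E_{1,1}(τ, 1, s)`, continued in `s`.
    ∀ F₀ F₁ : ℂ → ℂ[X],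
      VectorEisenstein.IsContinuation 1 1 0 (by decide) (by decide) τ F₀ →
      VectorEisenstein.IsContinuation 1 1 1 (by decide) (by decide) τ F₁ →
      (∀ i : ℕ, AnalyticAt ℂ (fun s => (F₁ s).coeff i) 0) ∧
      (∀ i : ℕ, -1 ≤ meromorphicOrderAt (fun s => (F₀ s).coeff i) 1) ∧
      VectorEisenstein.E2vec τ =
        F₁ 0 + C (2 * Complex.I) * VectorEisenstein.polyResidue 1 F₀ 1 := by 
  have hpar : Even ((1 : ℤ) - (1 : ℕ)) := by decide
  refine ⟨fun j hj s hs i => ?_, fun j hj => ?_, fun F₀ F₁ h₀ h₁ => ?_⟩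
  · rcases le_or_gt 2 i with hi | hi
    · simp only [summand_coeff_eq_zero τ s _ hj hpar hi]
      exact summable_zero
    · interval_cases j
      · exact (hasSum_summand_zero τ hs hpar (Nat.lt_succ_iff.1 hi)).summable
      · exact (hasSum_summand_one τ (by linarith) hpar (Nat.lt_succ_iff.1 hi)).summable
  · interval_cases j
    · exact exists_isContinuation hj hpar τ (coeffZero τ) (meromorphicOn_coeffZero τ)
        (fun i s hs => analyticAt_coeffZero τ i hs)
        (fun i hi s hs => (hasSum_summand_zero τ hs hpar hi).tsum_eq.symm)
    · exact exists_isContinuation hj hpar τ (coeffOne τ) (meromorphicOn_coeffOne τ)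
        (fun i s hs => analyticAt_coeffOne τ i (by linarith))
        (fun i hi s hs => (hasSum_summand_one τ (by linarith) hpar hi).tsum_eq.symm)
  · obtain ⟨h, hh, hh0, hh1, hheq⟩ := exists_coeffZero_eq_div τ
    have hF₁ : ∀ i ≤ 1, (fun s => (F₁ s).coeff i) =ᶠ[𝓝 0] coeffOne τ i := fun i hi =>
      h₁.coeff_eventuallyEq_nhds hi (meromorphicOn_coeffOne τ i)
        (fun s hs => (hasSum_summand_one τ (by linarith) hpar hi).tsum_eq.symm)
        (analyticAt_coeffOne τ i (by norm_num))
    have hF₀ : ∀ i ≤ 1, (fun s => (F₀ s).coeff i) =ᶠ[𝓝[≠] 1] fun s => h i s / (s - 1) :=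
      fun i hi => (h₀.coeff_eventuallyEq hi (meromorphicOn_coeffZero τ i)
        (fun s hs => (hasSum_summand_zero τ hs hpar hi).tsum_eq.symm) 1).trans (hheq i)
    refine ⟨fun i => ?_, fun i => ?_, ?_⟩
    · rcases le_or_gt 2 i with hi | hi
      · simp only [h₁.coeff_eq_zero hi]
        exact analyticAt_const
      · exact (analyticAt_coeffOne τ i (by norm_num)).congr (hF₁ i (Nat.lt_succ_iff.1 hi)).symm
    · rcases le_or_gt 2 i with hi | hi
      · exact neg_one_le_meromorphicOrderAt (h := fun _ => 0) analyticAt_const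
          (by simp [h₀.coeff_eq_zero hi])
      · exact neg_one_le_meromorphicOrderAt (hh i) (hF₀ i (Nat.lt_succ_iff.1 hi))
    · have hπ : (Real.pi : ℂ) ≠ 0 := Complex.ofReal_ne_zero.2 Real.pi_ne_zero
      have hy : (τ.im : ℂ) ≠ 0 := by exact_mod_cast τ.im_pos.ne'
      have hI := Complex.I_ne_zero
      ext i
      rw [E2vec, polyResidue, coeff_sub, coeff_mul_C, coeff_sub, coeff_add, coeff_C_mul]
      simp only [finsetSum_coeff, coeff_monomial, Finset.sum_ite_eq', Finset.mem_range]
      rcases le_or_gt 2 i with hi | hi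
      · rw [h₁.coeff_eq_zero hi, if_neg (by omega), coeff_X, if_neg (by omega),
          coeff_C_of_ne_zero (by omega), coeff_C_of_ne_zero (by omega)]
        simp
      · rw [if_pos hi, (hF₁ i (Nat.lt_succ_iff.1 hi)).eq_of_nhds,
          residue_eq_of_eventuallyEq (hh i) (hF₀ i (Nat.lt_succ_iff.1 hi))]
        -- In both coefficients the −3/(πy) of `weightTwo_zero` cancels against 2i · (3/π)/(2iy). In
        -- the constant coefficient 2i · 3/π remains, which is −6/(πi).
        interval_cases i
        · simp only [coeffOne, weightTwo_zero, hh0, coeff_X_zero, coeff_C_zero]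
          field_simp
          linear_combination (-6 * τ.im : ℂ) * Complex.I_sq
        · simp only [coeffOne, weightTwo_zero, hh1, coeff_X_one, coeff_C_of_ne_zero one_ne_zero]
          field_simp
          ring
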